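/- Let $T=(T_1,T_2)\in\mathbb R^2$ be a unit vector, let $\kappa,\kappa_\Gamma,s\in\mathbb R$ with $1-s\kappa_\Gamma>0$, and suppose that the matrix $$\mathrm{II}=-\frac{\kappa}{1-s\kappa_\Gamma}\begin{pmatrix}T_1^2&T_1T_2\\T_1T_2&T_2^2\end{pmatrix}$$ is nonzero. Let $Y=[0,1)^2$ and let $\psi\in H^2_{\rm per}(Y)$, i.e. $\psi:\mathbb R^2\to\mathbb R$ is $1$-periodic in each variable (almost everywhere), and $\psi$ and its weak partial derivatives on $\mathbb R^2$ of first and second order are square integrable on $Y$. Suppose that $$\det\bigl(\mathrm{II}+\nabla^2\psi(y)\bigr)=0\qquad\text{for a.e. } y.$$ Then the (weak) derivative of $\psi$ in the direction $(-T_2,T_1)$ is zero, and there is a continuous function $\psi_T:\mathbb R\to\mathbb R$ such that $$\psi(y_1,y_2)=\psi_T(T_1y_1+T_2y_2)\qquad\text{for a.e. } y\in\mathbb R^2$$ (hence for every $y$, if $\psi$ denotes its continuous representative). Moreover: 1. if $T_1=0$ or $T_2=0$, then $\psi_T$ is $1$-periodic; 2. if $T_1,T_2\neq0$ and $T_1/T_2=p/q$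 with coprime integers $p,q$, $q\ne0$, then $|T_1/p|=|T_2/q|=:P$ and $\psi_T$ is periodic with period $P$; 3. if $T_1/T_2$ is irrational, then $\psi_T$ is constant, and hence $\psi$ is constant (a.e.). -/

import Mathlib

open MeasureTheory
open scoped ContDiff

/-- The Euclidean plane, carrying Lebesgue measure `volume`. -/
abbrev Plane : Type := EuclideanSpace ℝ (Fin 2)

/-- The unit cell `Y = [0,1)²`. -/
def unitCell : Set Plane := {y | ∀ i, y i ∈ Set.Ico (0 : ℝ) 1}

/-- `g` is the weak derivative on `ℝ²` of `f` in the direction `v`, in the sense of testing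
against smooth compactly supported functions. -/
def IsWeakDeriv (v : Plane) (f g : Plane → ℝ) : Prop :=
  LocallyIntegrable f ∧ LocallyIntegrable g ∧
    ∀ φ : Plane → ℝ, ContDiff ℝ ∞ φ → HasCompactSupport φ →
      ∫ y, f y * fderiv ℝ φ y v = - ∫ y, g y * φ y

/-- `g` is the `i`-th weak partial derivative of `f` on `ℝ²`. -/
def IsWeakPartial (i : Fin 2) (f g : Plane → ℝ) : Prop :=
  IsWeakDeriv (EuclideanSpace.single i (1 : ℝ)) f g

/-- `H` is the matrix `∇²ψ` of weak second partial derivatives of `ψ` on `ℝ²`. -/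
def IsWeakHessian (ψ : Plane → ℝ) (H : Plane → Matrix (Fin 2) (Fin 2) ℝ) : Prop :=
  ∃ g : Fin 2 → Plane → ℝ,
    (∀ i, IsWeakPartial i ψ (g i)) ∧ ∀ i j, IsWeakPartial j (g i) (fun y => H y i j)

/-- `ψ` (a function on the plane, up to a.e. equality) belongs to `H²_per(Y)`: it is `1`-periodic
in both variables, and `ψ` and its weak partial derivatives on `ℝ²` of orders one and two are
square integrable on the unit cell. Since the weak derivatives are taken on the whole plane, the
traces of `ψ` and `∇ψ` match on opposite sides of the cell. -/
def MemH2Per (ψ : Plane → ℝ) : Prop :=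
  (∀ i : Fin 2, (fun y => ψ (y + EuclideanSpace.single i (1 : ℝ))) =ᵐ[volume] ψ) ∧
  MemLp ψ 2 (volume.restrict unitCell) ∧
  ∃ (g : Fin 2 → Plane → ℝ) (H : Plane → Matrix (Fin 2) (Fin 2) ℝ),
    (∀ i, IsWeakPartial i ψ (g i) ∧ MemLp (g i) 2 (volume.restrict unitCell)) ∧
    ∀ i j, IsWeakPartial j (g i) (fun y => H y i j) ∧
      MemLp (fun y => H y i j) 2 (volume.restrict unitCell)

/-- The matrix `-κ (1 - s κ_Γ)⁻¹ T ⊗ T`. -/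
noncomputable def rankOneForm (κ κΓ s : ℝ) (T : Plane) : Matrix (Fin 2) (Fin 2) ℝ :=
  (-(κ / (1 - s * κΓ))) • !![T 0 ^ 2, T 0 * T 1; T 0 * T 1, T 1 ^ 2]

/-! Write `a`, `b` for the derivatives of `ψ` along `v = T` and `w = (-T₂, T₁)`, and `ψ_vv`, `ψ_vw`,
`ψ_ww` for the second derivatives. Since `II = c T ⊗ T` with `c ≠ 0`, the equation in this
orthonormal frame is `D = -c ψ_ww`, where `D = ψ_vv ψ_ww - ψ_vw²`.

For smooth periodic `ψ`, integration by parts over the cell gives `∫ ψ D = -(3/2) ∫ ψ_vv b²`, `∫ a²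
ψ_ww = ∫ ψ_vv b²`, and `∫ F(a) D = 0` for every `F` (`integral_mul_hessDet`,
`integral_sq_dirDeriv_mul`, `integral_comp_dirDeriv_mul_hessDet`). Formally, `F(t) = t²` and the
equation give `∫ a² ψ_ww = 0`, so `∫ ψ D = 0`. But the equation also gives `∫ ψ D = -c ∫ ψ ψ_ww = c
∫ b²`, so `b = 0`.

For `ψ` in `H²` the determinants of the mollified functions converge only in `L¹`, so they may be
tested only against bounded functions. Mollifications of `ψ` are uniformly bounded because they
converge uniformly (`mollify_uniformCauchy`). The square `t²` is replaced by the bounded function `1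
- cos (δ t)`, rescaled by `2 / δ²`, with `δ → 0` at the end. The cubic integrals pass to the limit
because the gradients converge in `L⁴` (`tendsto_eLpNorm_four_mollify`). All this is combined in
`weakDeriv_eq_zero_of_det_eq_zero`.

Once `b = 0`, `ψ` is a function of `T · y`, and each lattice vector `k` yields the period `T · k` of
the profile. These periods form a dense group for irrational slope, and Bézout's identity produces
the stated period for rational slope. -/

open Filter Topology ENNReal
open scoped Convolution

/-! ### Periodic functions and integration over the unit cell -/

/-- A function on the plane that is `1`-periodic in each variable. -/
def CellPeriodic (f : Plane → ℝ) : Prop :=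
  ∀ (i : Fin 2) (y : Plane), f (y + EuclideanSpace.single i (1 : ℝ)) = f y

/-- The standard basis of the plane. -/
noncomputable abbrev planeBasis : Module.Basis (Fin 2) ℝ Plane :=
  (EuclideanSpace.basisFun (Fin 2) ℝ).toBasis

/-- The lattice `ℤ²` in the plane. -/
abbrev planeLattice : Submodule ℤ Plane := Submodule.span ℤ (Set.range planeBasis)

/-- Lebesgue measure on the unit cell. -/
noncomputable abbrev cellMeasure : Measure Plane := volume.restrict unitCell

theorem unitCell_eq_fundamentalDomain : unitCell = ZSpan.fundamentalDomain planeBasis := by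
  ext y
  simp [unitCell, ZSpan.mem_fundamentalDomain]

theorem measurableSet_unitCell : MeasurableSet unitCell := by
  rw [unitCell_eq_fundamentalDomain]
  exact ZSpan.fundamentalDomain_measurableSet _

theorem volume_unitCell : volume unitCell = 1 := by
  rw [unitCell_eq_fundamentalDomain,
    measure_congr (ZSpan.fundamentalDomain_ae_parallelepiped planeBasis volume)]
  simpa using (EuclideanSpace.basisFun (Fin 2) ℝ).volume_parallelepiped

instance isProbabilityMeasure_cellMeasure : IsProbabilityMeasure cellMeasure :=
  ⟨by rw [Measure.restrict_apply_univ, volume_unitCell]⟩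

theorem isAddFundamentalDomain_unitCell :
    IsAddFundamentalDomain planeLattice unitCell (volume : Measure Plane) := by
  rw [unitCell_eq_fundamentalDomain]
  exact ZSpan.isAddFundamentalDomain planeBasis volume

instance vaddInvariantMeasure_planeLattice :
    VAddInvariantMeasure planeLattice Plane (volume : Measure Plane) :=
  ⟨fun c _ _ => measure_preimage_add volume (c : Plane) _⟩

theorem CellPeriodic.add_lattice {f : Plane → ℝ} (hf : CellPeriodic f) {v : Plane}
    (hv : v ∈ planeLattice) (y : Plane) : f (y + v) = f y := by
  induction hv using Submodule.span_induction generalizing y with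
  | mem x hx =>
    obtain ⟨i, rfl⟩ := hx
    simpa using hf i y
  | zero => simp
  | add x z _ _ hx hz => rw [← add_assoc, hz, hx]
  | smul n x _ hx =>
    induction n using Int.induction_on generalizing y with
    | zero => simp
    | succ n ih => rw [add_smul, one_smul, ← add_assoc, hx, ih]
    | pred n ih => rw [sub_smul, one_smul, ← hx (y + _), add_assoc, sub_add_cancel, ih]

theorem lattice_combination_mem (a b : ℤ) : (!₂[(a : ℝ), (b : ℝ)] : Plane) ∈ planeLattice := by
  have h : (!₂[(a : ℝ), (b : ℝ)] : Plane) = a • planeBasis 0 + b • planeBasis 1 := by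
    ext i; fin_cases i <;> simp
  rw [h]
  exact add_mem (Submodule.smul_mem _ _ (Submodule.subset_span ⟨0, rfl⟩))
    (Submodule.smul_mem _ _ (Submodule.subset_span ⟨1, rfl⟩))

/-- Translations commute with the lattice action. This makes integrals of periodic functions over
the cell translation invariant, since any two fundamental domains give the same integral. -/
theorem preimage_add_isAddFundamentalDomain (t : Plane) :
    IsAddFundamentalDomain planeLattice ((fun y => y + t) ⁻¹' unitCell)
      (volume : Measure Plane) := by
  refine isAddFundamentalDomain_unitCell.preimage_of_equiv (f := fun y => y + t)
    (measurePreserving_add_right volume t).quasiMeasurePreserving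
    (e := id) Function.bijective_id ?_
  intro g x
  simp [Submodule.vadd_def, add_assoc]

theorem setLIntegral_cell_translate {F : Plane → ℝ≥0∞}
    (hF : ∀ v ∈ planeLattice, ∀ y, F (v + y) = F y) (t : Plane) :
    ∫⁻ y in unitCell, F (y + t) = ∫⁻ y in unitCell, F y := by
  have h := (measurePreserving_add_right (volume : Measure Plane) (-t)).setLIntegral_comp_preimage_emb
    (measurableEmbedding_addRight _) (fun y => F (y + t)) unitCell
  simp only [neg_add_cancel_right] at h
  rw [← h]
  exact (preimage_add_isAddFundamentalDomain (-t)).setLIntegral_eq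
    isAddFundamentalDomain_unitCell F (fun g x => by
      rw [Submodule.vadd_def, vadd_eq_add]; exact hF g g.2 x)

theorem CellPeriodic.setIntegral_translate {f : Plane → ℝ} (hf : CellPeriodic f) (t : Plane) :
    ∫ y in unitCell, f (y + t) = ∫ y in unitCell, f y := by
  have h := (measurePreserving_add_right (volume : Measure Plane) (-t)).setIntegral_preimage_emb
    (measurableEmbedding_addRight _) (fun y => f (y + t)) unitCell
  simp only [neg_add_cancel_right] at h
  rw [← h]
  exact (preimage_add_isAddFundamentalDomain (-t)).setIntegral_eq
    isAddFundamentalDomain_unitCell (f := f) (fun g x => by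
      rw [Submodule.vadd_def, vadd_eq_add, add_comm]; exact hf.add_lattice g.2 x)

/-! ### Exactly periodic representatives -/

/-- The periodic extension of the restriction of a function to the unit cell. -/
noncomputable def periodization (f : Plane → ℝ) : Plane → ℝ :=
  fun y => f (ZSpan.fract planeBasis y)

theorem cellPeriodic_periodization (f : Plane → ℝ) : CellPeriodic (periodization f) := by
  intro i y
  unfold periodization
  rw [ZSpan.fract_add_ZSpan]
  exact Submodule.subset_span ⟨i, by simp⟩

theorem ae_translate_lattice {f : Plane → ℝ}
    (hf : ∀ i : Fin 2, (fun y => f (y + EuclideanSpace.single i (1 : ℝ))) =ᵐ[volume] f)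
    {v : Plane} (hv : v ∈ planeLattice) : (fun y => f (y + v)) =ᵐ[volume] f := by
  have tr : ∀ (w : Plane) {g h : Plane → ℝ}, g =ᵐ[volume] h →
      (fun y => g (y + w)) =ᵐ[volume] fun y => h (y + w) := fun w g h hgh =>
    (measurePreserving_add_right (volume : Measure Plane) w).quasiMeasurePreserving.ae_eq_comp hgh
  induction hv using Submodule.span_induction with
  | mem x hx =>
    obtain ⟨i, rfl⟩ := hx
    simpa using hf i
  | zero => simp
  | add x z _ _ hx hz =>
    have := (tr x hz).trans hx
    simpa only [add_assoc] using this
  | smul n x _ hx =>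
    induction n using Int.induction_on with
    | zero => simp
    | succ n ih =>
      have := (tr x ih).trans hx
      refine Filter.EventuallyEq.trans (Filter.Eventually.of_forall fun y => ?_) this
      simp only [add_smul, one_smul]
      congr 1; abel
    | pred n ih =>
      have h1 := (tr (-x) hx).symm
      simp only [neg_add_cancel_right] at h1
      have := (tr (-x) ih).trans h1
      refine Filter.EventuallyEq.trans (Filter.Eventually.of_forall fun y => ?_) this
      simp only [sub_smul, one_smul]
      congr 1; abel

theorem periodization_ae_eq {f : Plane → ℝ}
    (hf : ∀ i : Fin 2, (fun y => f (y + EuclideanSpace.single i (1 : ℝ))) =ᵐ[volume] f) :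
    periodization f =ᵐ[volume] f := by
  -- The lattice is countable, so one null set serves all translations; this is needed because the
  -- floor used below depends on `y`.
  have h : ∀ᵐ y : Plane, ∀ v : planeLattice, f (y + v) = f y :=
    ae_all_iff.2 fun v => ae_translate_lattice hf v.2
  filter_upwards [h] with y hy
  have := hy (-(ZSpan.floor planeBasis y))
  rw [← this, periodization, ZSpan.fract_apply, sub_eq_add_neg]
  rfl

theorem CellPeriodic.ae_zero_of_cell {f : Plane → ℝ} (hf : CellPeriodic f)
    (h : ∀ᵐ y ∂cellMeasure, f y = 0) : ∀ᵐ y : Plane, f y = 0 := by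
  have h1 : volume ({y | ¬ f y = 0} ∩ unitCell) = 0 := by
    rw [← Measure.restrict_apply₀' measurableSet_unitCell.nullMeasurableSet]
    exact h
  refine isAddFundamentalDomain_unitCell.measure_zero_of_invariant _ (fun g => ?_) h1
  ext y
  rw [Set.mem_vadd_set_iff_neg_vadd_mem]
  have : f (-g +ᵥ y) = f y := by
    rw [Submodule.vadd_def, vadd_eq_add, add_comm]
    exact hf.add_lattice (-g).2 y
  change ¬ (f (-g +ᵥ y) = 0) ↔ ¬ (f y = 0)
  rw [this]

theorem CellPeriodic.eq_fract {f : Plane → ℝ} (hf : CellPeriodic f) (y : Plane) :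
    f (ZSpan.fract planeBasis y) = f y := by
  rw [ZSpan.fract_apply, sub_eq_add_neg]
  exact hf.add_lattice (neg_mem (ZSpan.floor planeBasis y).2) y

/-! ### Mollification and convergence in `L²` of the cell -/

/-- By the parallelogram law `‖F n - f‖² + ‖F n + f‖² ≤ 4 ‖f‖²`, while Fatou gives `4 ‖f‖² ≤ liminf
‖F n + f‖²`; hence the first term tends to zero. -/
theorem tendsto_eLpNorm_two_of_lintegral_le {α : Type*} [MeasurableSpace α] {μ : Measure α}
    {f : α → ℝ} {F : ℕ → α → ℝ} (hf : MemLp f 2 μ) (hF : ∀ n, AEStronglyMeasurable (F n) μ)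
    (hae : ∀ᵐ x ∂μ, Tendsto (fun n => F n x) atTop (𝓝 (f x)))
    (hle : ∀ n, ∫⁻ x, ‖F n x‖ₑ ^ 2 ∂μ ≤ ∫⁻ x, ‖f x‖ₑ ^ 2 ∂μ) :
    Tendsto (fun n => eLpNorm (F n - f) 2 μ) atTop (𝓝 0) := by
  have sq : ∀ g : α → ℝ, eLpNorm g 2 μ ^ 2 = ∫⁻ x, ‖g x‖ₑ ^ 2 ∂μ := fun g => by
    rw [eLpNorm_eq_lintegral_rpow_enorm_toReal (by simp) (by simp), ← ENNReal.rpow_natCast,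
      ← ENNReal.rpow_mul]
    simp
  set A := ∫⁻ x, ‖f x‖ₑ ^ 2 ∂μ with hA
  have hAtop : A ≠ ⊤ := by
    rw [hA, ← sq]; exact ENNReal.pow_ne_top hf.2.ne
  set d : ℕ → ℝ≥0∞ := fun n => ∫⁻ x, ‖F n x - f x‖ₑ ^ 2 ∂μ
  set s : ℕ → ℝ≥0∞ := fun n => ∫⁻ x, ‖F n x + f x‖ₑ ^ 2 ∂μ
  have meas : ∀ g : α → ℝ, AEStronglyMeasurable g μ → AEMeasurable (fun x => ‖g x‖ₑ ^ 2) μ :=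
    fun g hg => hg.enorm.pow_const 2
  have hds : ∀ n, d n + s n ≤ 4 * A := fun n => by
    have h1 : d n + s n = ∫⁻ x, (2 * ‖F n x‖ₑ ^ 2 + 2 * ‖f x‖ₑ ^ 2) ∂μ := by
      rw [← lintegral_add_left' (meas (fun x => F n x - f x) ((hF n).sub hf.1))]
      refine lintegral_congr fun x => ?_
      simp only [Real.enorm_eq_ofReal_abs, ← ENNReal.ofReal_pow (abs_nonneg _), sq_abs]
      rw [← ENNReal.ofReal_add (by positivity) (by positivity), show (2 : ℝ≥0∞) = ENNReal.ofReal 2 by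
        simp, ← ENNReal.ofReal_mul (by positivity), ← ENNReal.ofReal_mul (by positivity),
        ← ENNReal.ofReal_add (by positivity) (by positivity)]
      congr 1; ring
    rw [h1, lintegral_add_left' ((meas _ (hF n)).const_mul 2), lintegral_const_mul'' _ (meas _ (hF n)),
      lintegral_const_mul'' _ (meas _ hf.1)]
    calc _ ≤ 2 * A + 2 * A := by gcongr; exact hle n
      _ = 4 * A := by ring
  have hs : 4 * A ≤ liminf s atTop := by
    calc 4 * A = ∫⁻ x, liminf (fun n => ‖F n x + f x‖ₑ ^ 2) atTop ∂μ := by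
          rw [hA, ← lintegral_const_mul'' _ (meas _ hf.1)]
          refine lintegral_congr_ae ?_
          filter_upwards [hae] with x hx
          have : Tendsto (fun n => ‖F n x + f x‖ₑ ^ 2) atTop (𝓝 (‖f x + f x‖ₑ ^ 2)) :=
            ((ENNReal.continuous_pow 2).tendsto _).comp ((hx.add_const _).enorm)
          rw [this.liminf_eq, ← two_mul, enorm_mul, mul_pow]
          congr 1
          rw [show ‖(2 : ℝ)‖ₑ = 2 by simp [Real.enorm_eq_ofReal_abs]]; norm_num
      _ ≤ _ := lintegral_liminf_le' fun n => meas _ ((hF n).add hf.1)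
  have hd : Tendsto d atTop (𝓝 0) := by
    rw [ENNReal.tendsto_nhds_zero]
    intro ε hε
    rcases eq_or_ne (4 * A) 0 with h0 | h0
    · exact Eventually.of_forall fun n =>
        (le_self_add.trans (hds n)).trans (by rw [h0]; exact zero_le)
    · have h4 : 4 * A ≠ ⊤ := ENNReal.mul_ne_top (by simp) hAtop
      have : 4 * A - ε < liminf s atTop := (ENNReal.sub_lt_self h4 h0 hε.ne').trans_le hs
      filter_upwards [eventually_lt_of_lt_liminf this] with n hn
      have h5 : s n ≠ ⊤ := ne_top_of_le_ne_top h4 (le_add_self.trans (hds n))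
      have h6 : 4 * A ≤ ε + s n := by
        rw [add_comm]; exact tsub_le_iff_right.1 hn.le
      exact (ENNReal.add_le_add_iff_right h5).1 ((hds n).trans h6)
  have h2 : Tendsto (fun n => (d n) ^ (1 / 2 : ℝ)) atTop (𝓝 0) := by
    have := ((ENNReal.continuous_rpow_const (y := (1 / 2 : ℝ))).tendsto 0).comp hd
    simpa using! this
  refine h2.congr fun n => ?_
  rw [eLpNorm_eq_lintegral_rpow_enorm_toReal (by simp) (by simp)]
  simp [d]

/-- A sequence of bump functions on the plane shrinking to the origin. -/
noncomputable def shrinkingBump (n : ℕ) : ContDiffBump (0 : Plane) where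
  rIn := 1 / (n + 1)
  rOut := 2 / (n + 1)
  rIn_pos := by positivity
  rIn_lt_rOut := by gcongr; norm_num

/-- The mollification of `f` at scale `2 / (n + 1)`. -/
noncomputable def mollify (n : ℕ) (f : Plane → ℝ) : Plane → ℝ :=
  (shrinkingBump n).normed volume ⋆[ContinuousLinearMap.lsmul ℝ ℝ, volume] f

theorem mollify_apply (n : ℕ) (f : Plane → ℝ) (x : Plane) :
    mollify n f x = ∫ t, (shrinkingBump n).normed volume t * f (x - t) := rfl

theorem mollify_apply' (n : ℕ) (f : Plane → ℝ) (x : Plane) :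
    mollify n f x = ∫ t, f t * (shrinkingBump n).normed volume (x - t) := by
  rw [mollify_apply, ← integral_sub_left_eq_self _ volume x]
  simp [mul_comm]

theorem contDiff_mollify (n : ℕ) {f : Plane → ℝ} (hf : LocallyIntegrable f) :
    ContDiff ℝ ∞ (mollify n f) :=
  (shrinkingBump n).hasCompactSupport_normed.contDiff_convolution_left _
    (shrinkingBump n).contDiff_normed hf

theorem mollify_congr (n : ℕ) {f g : Plane → ℝ} (h : f =ᵐ[volume] g) :
    mollify n f = mollify n g := by
  ext x
  rw [mollify_apply', mollify_apply']
  refine integral_congr_ae ?_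
  filter_upwards [h] with t ht
  rw [ht]

theorem CellPeriodic.mollify (n : ℕ) {f : Plane → ℝ} (hf : CellPeriodic f) :
    CellPeriodic (mollify n f) := by
  intro i y
  simp only [mollify_apply]
  refine integral_congr_ae (Eventually.of_forall fun t => ?_)
  simp only [add_sub_right_comm y, hf i]

/-- Lebesgue differentiation; it requires the ratio of outer to inner radius to stay bounded, and
here that ratio is always 2. -/
theorem ae_tendsto_mollify {f : Plane → ℝ} (hf : LocallyIntegrable f) :
    ∀ᵐ x : Plane, Tendsto (fun n => mollify n f x) atTop (𝓝 (f x)) := by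
  refine ContDiffBump.ae_convolution_tendsto_right_of_locallyIntegrable (φ := shrinkingBump)
    (K := 2) ?_ (Eventually.of_forall fun n => ?_) hf
  · exact tendsto_const_div_atTop_nhds_zero_nat (2 : ℝ) |>.comp (tendsto_add_atTop_nat 1)
      |>.congr fun n => by simp [shrinkingBump]
  · simp only [shrinkingBump]
    rw [mul_one_div]

/-- The derivative falls on the kernel, and `t ↦ ρ (x - t)` is an admissible test function. The sign
from the chain rule cancels the one in the weak derivative. -/
theorem IsWeakDeriv.fderiv_mollify {v : Plane} {f g : Plane → ℝ} (h : IsWeakDeriv v f g) (n : ℕ)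
    (x : Plane) : fderiv ℝ (mollify n f) x v = mollify n g x := by
  obtain ⟨hf, hg, H⟩ := h
  set ρ := (shrinkingBump n).normed volume with hρ
  have hc : HasCompactSupport ρ := (shrinkingBump n).hasCompactSupport_normed
  have hs : ContDiff ℝ ∞ ρ := (shrinkingBump n).contDiff_normed
  have h1 : HasFDerivAt (mollify n f) _ x :=
    hc.hasFDerivAt_convolution_left (ContinuousLinearMap.lsmul ℝ ℝ) (hs.of_le (by simp)) hf x
  rw [h1.fderiv]
  have hc' : HasCompactSupport (fderiv ℝ ρ) := hc.fderiv ℝ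
  have hcont : Continuous (fderiv ℝ ρ) := hs.continuous_fderiv (by simp)
  have h2 := convolution_precompR_apply (μ := volume) (ContinuousLinearMap.lsmul ℝ ℝ).flip
    hf hc' hcont x v
  have h3 : ((fderiv ℝ ρ ⋆[(ContinuousLinearMap.lsmul ℝ ℝ).precompL Plane, volume] f) x) v
      = (f ⋆[(ContinuousLinearMap.lsmul ℝ ℝ : ℝ →L[ℝ] ℝ →L[ℝ] ℝ).flip, volume]
          fun a => (fderiv ℝ ρ a) v) x := by
    rw [← h2, ← convolution_flip]
    rfl
  rw [h3, mollify_apply']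
  have h4 : ContDiff ℝ ∞ fun t => ρ (x - t) := hs.comp (contDiff_const.sub contDiff_id)
  have h5 : HasCompactSupport fun t => ρ (x - t) :=
    hc.comp_homeomorph (Homeomorph.subLeft x)
  have h6 := H _ h4 h5
  rw [← neg_eq_iff_eq_neg, ← integral_neg] at h6
  rw [← h6]
  simp only [convolution, ContinuousLinearMap.flip_apply, ContinuousLinearMap.lsmul_apply,
    smul_eq_mul]
  refine integral_congr_ae (Eventually.of_forall fun t => ?_)
  have h7 : HasFDerivAt (fun t => ρ (x - t)) ((fderiv ℝ ρ (x - t)).comp (-.id ℝ Plane)) t :=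
    ((hs.differentiable (by simp)) (x - t)).hasFDerivAt.comp t ((hasFDerivAt_id t).const_sub x)
  simp only [h7.fderiv]
  simp [mul_comm]

/-- Mollification averages translates of `f` against the probability measure `ν`. Bound the square
of the average by the average of the squares, exchange the integrals, and use translation invariance
over the cell. -/
theorem lintegral_mollify_le (n : ℕ) {f : Plane → ℝ} (hf : CellPeriodic f)
    (hm : AEStronglyMeasurable f volume) :
    ∫⁻ x in unitCell, ‖mollify n f x‖ₑ ^ 2 ≤ ∫⁻ x in unitCell, ‖f x‖ₑ ^ 2 := by
  set ρ := (shrinkingBump n).normed volume with hρ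
  have hρc : Continuous ρ := (shrinkingBump n).continuous_normed
  have hρ0 : ∀ t, 0 ≤ ρ t := (shrinkingBump n).nonneg_normed
  set ν : Measure Plane := volume.withDensity fun t => ENNReal.ofReal (ρ t) with hν
  have hνp : IsProbabilityMeasure ν := ⟨by
    rw [hν, withDensity_apply _ MeasurableSet.univ, Measure.restrict_univ,
      ← ofReal_integral_eq_lintegral_ofReal (shrinkingBump n).integrable_normed
        (Eventually.of_forall hρ0), (shrinkingBump n).integral_normed, ENNReal.ofReal_one]⟩
  have hνac : ν ≪ volume := withDensity_absolutelyContinuous _ _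
  have hrep : ∀ x, mollify n f x = ∫ t, f (x - t) ∂ν := fun x => by
    rw [mollify_apply, hν, integral_withDensity_eq_integral_toReal_smul
      hρc.measurable.ennreal_ofReal (by simp)]
    refine integral_congr_ae (Eventually.of_forall fun t => ?_)
    simp only [smul_eq_mul]
    rw [ENNReal.toReal_ofReal (hρ0 t)]
  have hmeas : AEStronglyMeasurable (fun p : Plane × Plane => f (p.1 - p.2))
      (cellMeasure.prod ν) :=
    (hm.comp_quasiMeasurePreserving (quasiMeasurePreserving_sub volume volume)).mono_ac
      ((Measure.restrict_le_self).absolutelyContinuous.prod hνac)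
  have hx : ∀ x, AEStronglyMeasurable (fun t => f (x - t)) ν := fun x =>
    (hm.comp_quasiMeasurePreserving
      (quasiMeasurePreserving_sub_left volume x)).mono_ac hνac
  have hpt : ∀ x, ‖mollify n f x‖ₑ ^ 2 ≤ ∫⁻ t, ‖f (x - t)‖ₑ ^ 2 ∂ν := fun x => by
    rw [hrep]
    have h1 := eLpNorm_le_eLpNorm_of_exponent_le (p := 1) (q := 2) (by norm_num) (hx x)
    rw [eLpNorm_one_eq_lintegral_enorm,
      eLpNorm_eq_lintegral_rpow_enorm_toReal (by simp) (by simp)] at h1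
    calc _ ≤ (∫⁻ t, ‖f (x - t)‖ₑ ∂ν) ^ 2 := by
          gcongr; exact enorm_integral_le_lintegral_enorm _
      _ ≤ _ := pow_le_pow_left₀ zero_le h1 2
      _ = _ := by
        rw [← ENNReal.rpow_natCast, ← ENNReal.rpow_mul]
        simp
  calc _ ≤ ∫⁻ x in unitCell, ∫⁻ t, ‖f (x - t)‖ₑ ^ 2 ∂ν := lintegral_mono hpt
    _ = ∫⁻ t, (∫⁻ x in unitCell, ‖f (x - t)‖ₑ ^ 2) ∂ν :=
        lintegral_lintegral_swap (hmeas.enorm.pow_const 2)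
    _ = ∫⁻ t, (∫⁻ x in unitCell, ‖f x‖ₑ ^ 2) ∂ν := by
        refine lintegral_congr fun t => ?_
        simp only [sub_eq_add_neg]
        refine setLIntegral_cell_translate (F := fun x => ‖f x‖ₑ ^ 2) (fun v hv y => ?_) (-t)
        rw [add_comm, hf.add_lattice hv]
    _ = _ := by simp

theorem tendsto_eLpNorm_mollify_sub {f : Plane → ℝ} (hf : CellPeriodic f)
    (hi : LocallyIntegrable f) (h2 : MemLp f 2 cellMeasure) :
    Tendsto (fun n => eLpNorm (mollify n f - f) 2 cellMeasure) atTop (𝓝 0) :=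
  tendsto_eLpNorm_two_of_lintegral_le h2
    (fun n => (contDiff_mollify n hi).continuous.aestronglyMeasurable)
    (ae_restrict_of_ae (ae_tendsto_mollify hi))
    (fun n => lintegral_mollify_le n hf hi.aestronglyMeasurable)

/-! ### Calculus of smooth periodic functions -/

/-- The derivative of `f` in the direction `v`. -/
noncomputable def dirDeriv (v : Plane) (f : Plane → ℝ) : Plane → ℝ :=
  fun y => fderiv ℝ f y v

/-- A smooth function on the plane that is `1`-periodic in each variable. -/
structure SmoothPeriodic (f : Plane → ℝ) : Prop where
  smooth : ContDiff ℝ ∞ f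
  periodic : CellPeriodic f

namespace SmoothPeriodic

variable {f g : Plane → ℝ}

theorem differentiableAt (hf : SmoothPeriodic f) (y : Plane) : DifferentiableAt ℝ f y :=
  (hf.smooth.differentiable (by simp)) y

theorem continuous (hf : SmoothPeriodic f) : Continuous f := hf.smooth.continuous

theorem dirDeriv (hf : SmoothPeriodic f) (v : Plane) : SmoothPeriodic (dirDeriv v f) := by
  refine ⟨(hf.smooth.fderiv_right (m := ∞) (by simp)).clm_apply contDiff_const, fun i y => ?_⟩
  have h : (fun y => f (y + EuclideanSpace.single i (1 : ℝ))) = f := funext (hf.periodic i)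
  unfold _root_.dirDeriv
  rw [← fderiv_comp_add_right, h]

theorem mul (hf : SmoothPeriodic f) (hg : SmoothPeriodic g) :
    SmoothPeriodic fun y => f y * g y :=
  ⟨hf.smooth.mul hg.smooth, fun i y => by rw [hf.periodic, hg.periodic]⟩

theorem sub (hf : SmoothPeriodic f) (hg : SmoothPeriodic g) :
    SmoothPeriodic fun y => f y - g y :=
  ⟨hf.smooth.sub hg.smooth, fun i y => by rw [hf.periodic, hg.periodic]⟩

theorem add (hf : SmoothPeriodic f) (hg : SmoothPeriodic g) :
    SmoothPeriodic fun y => f y + g y :=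
  ⟨hf.smooth.add hg.smooth, fun i y => by rw [hf.periodic, hg.periodic]⟩

theorem comp (hf : SmoothPeriodic f) {F : ℝ → ℝ} (hF : ContDiff ℝ ∞ F) :
    SmoothPeriodic fun y => F (f y) :=
  ⟨hF.comp hf.smooth, fun i y => by rw [hf.periodic]⟩

theorem pow (hf : SmoothPeriodic f) (k : ℕ) : SmoothPeriodic fun y => f y ^ k :=
  hf.comp (F := fun t => t ^ k) (contDiff_id.pow k)

theorem dirDeriv_mul (hf : SmoothPeriodic f) (hg : SmoothPeriodic g) (v y : Plane) :
    _root_.dirDeriv v (fun y => f y * g y) y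
      = f y * _root_.dirDeriv v g y + _root_.dirDeriv v f y * g y := by
  unfold _root_.dirDeriv
  rw [fderiv_fun_mul (hf.differentiableAt y) (hg.differentiableAt y)]
  simp [mul_comm]

theorem dirDeriv_sub (hf : SmoothPeriodic f) (hg : SmoothPeriodic g) (v y : Plane) :
    _root_.dirDeriv v (fun y => f y - g y) y
      = _root_.dirDeriv v f y - _root_.dirDeriv v g y := by
  unfold _root_.dirDeriv
  rw [fderiv_fun_sub (hf.differentiableAt y) (hg.differentiableAt y)]
  simp

theorem dirDeriv_comp (hf : SmoothPeriodic f) {F : ℝ → ℝ} {F' : ℝ} {y : Plane}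
    (hF : HasDerivAt F F' (f y)) (v : Plane) :
    _root_.dirDeriv v (fun y => F (f y)) y = F' * _root_.dirDeriv v f y := by
  unfold _root_.dirDeriv
  have := hF.comp_hasFDerivAt y (hf.differentiableAt y).hasFDerivAt
  rw [show (fun y => F (f y)) = F ∘ f from rfl, this.fderiv]
  simp

theorem dirDeriv_pow (hf : SmoothPeriodic f) (k : ℕ) (v y : Plane) :
    _root_.dirDeriv v (fun y => f y ^ k) y = k * f y ^ (k - 1) * _root_.dirDeriv v f y :=
  hf.dirDeriv_comp (F := fun t => t ^ k) (hasDerivAt_pow k _) v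

theorem dirDeriv_comm (hf : SmoothPeriodic f) (v w : Plane) :
    _root_.dirDeriv v (_root_.dirDeriv w f) = _root_.dirDeriv w (_root_.dirDeriv v f) := by
  have h2 : Differentiable ℝ (fderiv ℝ f) :=
    (hf.smooth.fderiv_right (m := ∞) (by simp)).differentiable (by simp)
  have key : ∀ (a b y : Plane),
      _root_.dirDeriv a (_root_.dirDeriv b f) y = fderiv ℝ (fderiv ℝ f) y a b := fun a b y => by
    unfold _root_.dirDeriv
    rw [fderiv_clm_apply (h2 y) (differentiableAt_const b)]
    simp
  ext y
  rw [key, key]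
  exact (hf.smooth.contDiffAt.isSymmSndFDerivAt
    (by simpa using WithTop.coe_le_coe.2 (le_top : (2 : ℕ∞) ≤ ⊤))).eq v w

theorem exists_bound (hf : SmoothPeriodic f) : ∃ C, ∀ y, |f y| ≤ C := by
  obtain ⟨C, hC⟩ := (isCompact_closedBall (0 : Plane) (∑ i, ‖planeBasis i‖)).exists_bound_of_continuousOn
    hf.continuous.continuousOn
  refine ⟨C, fun y => ?_⟩
  rw [← hf.periodic.eq_fract y]
  exact hC _ (by simpa using ZSpan.norm_fract_le planeBasis y)

theorem memLp (hf : SmoothPeriodic f) (p : ℝ≥0∞) : MemLp f p cellMeasure := by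
  obtain ⟨C, hC⟩ := hf.exists_bound
  exact MemLp.of_bound hf.continuous.aestronglyMeasurable C (Eventually.of_forall hC)

theorem integrable (hf : SmoothPeriodic f) : Integrable f cellMeasure :=
  memLp_one_iff_integrable.1 (hf.memLp 1)

/-- Integrate `f (y + v) - f y = ∫₀¹ ∂_v f (y + s v) ds` over the cell: the left side vanishes and
every slice on the right has the same integral. No boundary terms appear, and `v` need not be a
coordinate direction. -/
theorem integral_dirDeriv (hf : SmoothPeriodic f) (v : Plane) :
    ∫ y in unitCell, _root_.dirDeriv v f y = 0 := by
  have hd := hf.dirDeriv v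
  obtain ⟨C, hC⟩ := hd.exists_bound
  have h1 : ∀ y, f (y + v) - f y = ∫ s in (0 : ℝ)..1, _root_.dirDeriv v f (y + s • v) := fun y => by
    have : ∀ s ∈ Set.uIcc (0 : ℝ) 1, HasDerivAt (fun s : ℝ => f (y + s • v))
        (_root_.dirDeriv v f (y + s • v)) s := fun s _ => by
      have h2 : HasDerivAt (fun s : ℝ => y + s • v) v s := by
        simpa using ((hasDerivAt_id s).smul_const v).const_add y
      exact (hf.differentiableAt (y + s • v)).hasFDerivAt.comp_hasDerivAt s h2
    rw [intervalIntegral.integral_eq_sub_of_hasDerivAt this]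
    · simp
    · exact (hd.continuous.comp (by fun_prop)).intervalIntegrable _ _
  have h3 : ∫ y in unitCell, (f (y + v) - f y) = 0 := by
    rw [integral_sub, hf.periodic.setIntegral_translate, sub_self]
    · obtain ⟨C, hC⟩ := hf.exists_bound
      exact Integrable.of_bound (hf.continuous.comp (by fun_prop)).aestronglyMeasurable C
        (Eventually.of_forall fun y => hC _)
    · exact hf.integrable
  simp_rw [h1, intervalIntegral.integral_of_le zero_le_one] at h3
  rw [integral_integral_swap] at h3
  · simp_rw [hd.periodic.setIntegral_translate] at h3
    simpa using h3
  · refine Integrable.of_bound (C := C) ?_ (Eventually.of_forall fun p => hC _)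
    exact Continuous.aestronglyMeasurable (hd.continuous.comp (by fun_prop))

end SmoothPeriodic

/-! ### Sobolev and interpolation inequalities -/

theorem abs_le_intervalIntegral_abs_add_abs_deriv {h h' : ℝ → ℝ} (hd : ∀ t, HasDerivAt h (h' t) t)
    (hc : Continuous h') : |h 0| ≤ ∫ t in (0 : ℝ)..1, (|h t| + |h' t|) := by
  have hh : Continuous h := continuous_iff_continuousAt.2 fun t => (hd t).continuousAt
  have h1 : ∀ t ∈ Set.Icc (0 : ℝ) 1, |h 0| ≤ |h t| + ∫ s in (0 : ℝ)..1, |h' s| := fun t ht => by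
    have h2 : ∫ s in (0 : ℝ)..t, h' s = h t - h 0 :=
      intervalIntegral.integral_eq_sub_of_hasDerivAt (fun s _ => hd s) (hc.intervalIntegrable _ _)
    have h3 : |∫ s in (0 : ℝ)..t, h' s| ≤ ∫ s in (0 : ℝ)..t, |h' s| :=
      intervalIntegral.abs_integral_le_integral_abs ht.1
    have h4 : ∫ s in (0 : ℝ)..t, |h' s| ≤ ∫ s in (0 : ℝ)..1, |h' s| :=
      intervalIntegral.integral_mono_interval le_rfl ht.1 ht.2
        (Eventually.of_forall fun s => abs_nonneg _) (hc.abs.intervalIntegrable _ _)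
    have h5 : |h 0| ≤ |h t| + |h t - h 0| := by
      have := abs_sub_abs_le_abs_sub (h 0) (h t)
      rw [abs_sub_comm] at this
      linarith
    rw [← h2] at h5
    linarith
  have h6 := intervalIntegral.integral_mono_on zero_le_one
    (continuous_const.intervalIntegrable (μ := volume) 0 1)
    ((hh.abs.add continuous_const).intervalIntegrable 0 1) h1
  simp only [Pi.add_apply] at h6
  rw [intervalIntegral.integral_add (hh.abs.intervalIntegrable _ _)
    (continuous_const.intervalIntegrable _ _)] at h6
  rw [intervalIntegral.integral_add (hh.abs.intervalIntegrable _ _)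
    (hc.abs.intervalIntegrable _ _)]
  simpa using h6

theorem intervalIntegral_intervalIntegral_eq_setIntegral_cell {K : Plane → ℝ} (hK : Continuous K) :
    ∫ t in (0 : ℝ)..1, ∫ s in (0 : ℝ)..1,
      K (t • EuclideanSpace.single 0 1 + s • EuclideanSpace.single 1 1) = ∫ y in unitCell, K y := by
  have mp : MeasurePreserving
      (fun p : ℝ × ℝ => WithLp.toLp 2 ((MeasurableEquiv.finTwoArrow (α := ℝ)).symm p))
      (volume : Measure (ℝ × ℝ)) (volume : Measure Plane) :=
    (PiLp.volume_preserving_toLp (Fin 2)).comp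
      (volume_preserving_finTwoArrow ℝ).symm
  have me : MeasurableEmbedding
      (fun p : ℝ × ℝ => WithLp.toLp 2 ((MeasurableEquiv.finTwoArrow (α := ℝ)).symm p)) :=
    (MeasurableEquiv.toLp 2 (Fin 2 → ℝ)).measurableEmbedding.comp
      (MeasurableEquiv.finTwoArrow (α := ℝ)).symm.measurableEmbedding
  have hpt : ∀ p : ℝ × ℝ, WithLp.toLp 2 ((MeasurableEquiv.finTwoArrow (α := ℝ)).symm p)
      = p.1 • (EuclideanSpace.single 0 1 : Plane) + p.2 • EuclideanSpace.single 1 1 := fun p => by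
    ext i; fin_cases i <;> simp [MeasurableEquiv.finTwoArrow]
  have hpre : (fun p : ℝ × ℝ => WithLp.toLp 2 ((MeasurableEquiv.finTwoArrow (α := ℝ)).symm p)) ⁻¹'
      unitCell = Set.Ico 0 1 ×ˢ Set.Ico 0 1 := by
    ext p
    simp [unitCell, Fin.forall_fin_two]
  rw [← mp.setIntegral_preimage_emb me, hpre]
  have hcont : Continuous fun p : ℝ × ℝ =>
      K (p.1 • (EuclideanSpace.single 0 1 : Plane) + p.2 • EuclideanSpace.single 1 1) :=
    hK.comp (by fun_prop)
  simp only [hpt]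
  rw [Measure.volume_eq_prod, setIntegral_prod]
  · simp only [intervalIntegral.integral_of_le zero_le_one, integral_Ico_eq_integral_Ioc]
  · exact (hcont.continuousOn.integrableOn_compact (isCompact_Icc.prod isCompact_Icc)).mono_set
      (Set.prod_mono Set.Ico_subset_Icc_self Set.Ico_subset_Icc_self)

namespace SmoothPeriodic

variable {f g : Plane → ℝ}

theorem abs_le_intervalIntegral (hf : SmoothPeriodic f) (v x : Plane) :
    |f x| ≤ ∫ t in (0 : ℝ)..1, (|f (x + t • v)| + |_root_.dirDeriv v f (x + t • v)|) := by
  have := abs_le_intervalIntegral_abs_add_abs_deriv (h := fun t : ℝ => f (x + t • v))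
    (h' := fun t : ℝ => _root_.dirDeriv v f (x + t • v)) (fun s => by
      have h2 : HasDerivAt (fun s : ℝ => x + s • v) v s := by
        simpa using ((hasDerivAt_id s).smul_const v).const_add x
      exact (hf.differentiableAt (x + s • v)).hasFDerivAt.comp_hasDerivAt s h2)
    ((hf.dirDeriv v).continuous.comp (by fun_prop))
  simpa using this

/-- The one-dimensional bound is applied along the first axis, then along the second axis to both
`f` and its first partial derivative. Of the second derivatives only the mixed one enters. -/
theorem abs_le_integral (hf : SmoothPeriodic f) (x : Plane) :
    |f x| ≤ ∫ y in unitCell, (|f y| + |_root_.dirDeriv (EuclideanSpace.single 1 1) f y|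
      + (|_root_.dirDeriv (EuclideanSpace.single 0 1) f y|
        + |_root_.dirDeriv (EuclideanSpace.single 1 1)
            (_root_.dirDeriv (EuclideanSpace.single 0 1) f) y|)) := by
  set e0 : Plane := EuclideanSpace.single 0 1
  set e1 : Plane := EuclideanSpace.single 1 1
  have h0 := hf.dirDeriv e0
  have h1 := hf.dirDeriv e1
  have h01 := h0.dirDeriv e1
  set G : Plane → ℝ := fun y => |f y| + |_root_.dirDeriv e1 f y|
      + (|_root_.dirDeriv e0 f y| + |_root_.dirDeriv e1 (_root_.dirDeriv e0 f) y|) with hG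
  have cG : Continuous G := (hf.continuous.abs.add h1.continuous.abs).add
    (h0.continuous.abs.add h01.continuous.abs)
  have pG : CellPeriodic G := fun i y => by
    simp only [hG, hf.periodic i, h0.periodic i, h1.periodic i, h01.periodic i]
  have hline : ∀ (q : Plane → ℝ), Continuous q → ∀ y, Continuous fun s : ℝ => q (y + s • e1) :=
    fun q hq y => hq.comp (by fun_prop)
  have step : ∀ t : ℝ, |f (x + t • e0)| + |_root_.dirDeriv e0 f (x + t • e0)|
      ≤ ∫ s in (0 : ℝ)..1, G (x + (t • e0 + s • e1)) := fun t => by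
    simp only [← add_assoc x]
    refine (add_le_add (hf.abs_le_intervalIntegral e1 _) (h0.abs_le_intervalIntegral e1 _)).trans ?_
    rw [← intervalIntegral.integral_add]
    · exact ((hline _ hf.continuous _).abs.add (hline _ h1.continuous _).abs).intervalIntegrable _ _
    · exact ((hline _ h0.continuous _).abs.add (hline _ h01.continuous _).abs).intervalIntegrable _ _
  calc |f x| ≤ ∫ t in (0 : ℝ)..1, (|f (x + t • e0)| + |_root_.dirDeriv e0 f (x + t • e0)|) :=
        hf.abs_le_intervalIntegral e0 x
    _ ≤ ∫ t in (0 : ℝ)..1, ∫ s in (0 : ℝ)..1, G (x + (t • e0 + s • e1)) := by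
        refine intervalIntegral.integral_mono zero_le_one ?_ ?_ step
        · refine Continuous.intervalIntegrable ?_ _ _
          have := hf.continuous
          have := h0.continuous
          fun_prop
        · refine Continuous.intervalIntegrable ?_ _ _
          refine intervalIntegral.continuous_parametric_intervalIntegral_of_continuous' ?_ _ _
          exact cG.comp (by fun_prop)
    _ = ∫ y in unitCell, G (x + y) :=
        intervalIntegral_intervalIntegral_eq_setIntegral_cell (K := fun y => G (x + y))
          (cG.comp (by fun_prop))
    _ = ∫ y in unitCell, G y := by
        simp only [add_comm x]
        exact pG.setIntegral_translate x

theorem integral_mul_dirDeriv (hf : SmoothPeriodic f) (hg : SmoothPeriodic g) (v : Plane) :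
    ∫ y in unitCell, f y * _root_.dirDeriv v g y
      = - ∫ y in unitCell, _root_.dirDeriv v f y * g y := by
  have h := (hf.mul hg).integral_dirDeriv v
  simp_rw [hf.dirDeriv_mul hg] at h
  rw [integral_add (hf.mul (hg.dirDeriv v)).integrable ((hf.dirDeriv v).mul hg).integrable] at h
  linarith

/-- A Gagliardo–Nirenberg inequality. With `a = ∂_v f` and `b = ∂_v a`, integration by parts gives
`∫ a⁴ = -3 ∫ a² b f`; Young's inequality bounds this by `½ ∫ a⁴ + (9/2) M² ∫ b²`, and the first term
is absorbed. -/
theorem integral_dirDeriv_pow_four_le (hf : SmoothPeriodic f) (v : Plane) {M : ℝ}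
    (hM : ∀ y, |f y| ≤ M) :
    ∫ y in unitCell, _root_.dirDeriv v f y ^ 4
      ≤ 9 * M ^ 2 * ∫ y in unitCell, _root_.dirDeriv v (_root_.dirDeriv v f) y ^ 2 := by
  have ha := hf.dirDeriv v
  have hb := ha.dirDeriv v
  set a := _root_.dirDeriv v f with ha'
  set b := _root_.dirDeriv v a with hb'
  have h1 := hf.integral_mul_dirDeriv (ha.pow 3) v
  have h2 := (ha.pow 3).integral_mul_dirDeriv hf v
  simp_rw [ha.dirDeriv_pow] at h1 h2
  rw [← ha', ← hb'] at h2
  have h3 : ∫ y in unitCell, a y ^ 4 ≤ ∫ y in unitCell,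
      (1 / 2 * a y ^ 4 + 9 / 2 * M ^ 2 * b y ^ 2) := by
    calc ∫ y in unitCell, a y ^ 4 = ∫ y in unitCell, a y ^ 3 * a y := by
          congr 1
      _ = ∫ y in unitCell, - ((3 : ℕ) * a y ^ (3 - 1) * b y * f y) := by
          rw [h2, integral_neg]
      _ ≤ _ := by
          refine integral_mono ?_ ?_ fun y => ?_
          · have := ((((ha.pow 2).mul hb).mul hf).comp (F := fun t => -(3 * t))
              (contDiff_const.mul contDiff_id).neg).integrable
            refine this.congr (Eventually.of_forall fun y => ?_)
            ring
          · exact ((ha.pow 4).integrable.const_mul _).add ((hb.pow 2).integrable.const_mul _)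
          · have hm := sq_le_sq' (abs_le.1 (hM y)).1 (abs_le.1 (hM y)).2
            have : b y ^ 2 * f y ^ 2 ≤ b y ^ 2 * M ^ 2 := by gcongr
            simp only [Nat.cast_ofNat]
            norm_num
            -- The square expands to `-3 a² b f ≤ ½ a⁴ + (9/2) b² f²`.
            nlinarith [sq_nonneg (a y ^ 2 + 3 * (b y * f y))]
  rw [integral_add ((ha.pow 4).integrable.const_mul _) ((hb.pow 2).integrable.const_mul _),
    integral_const_mul, integral_const_mul] at h3
  linarith

end SmoothPeriodic

/-! ### Integral identities for the Hessian determinant -/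

namespace SmoothPeriodic

variable {f g : Plane → ℝ}

/-- The factor `∂_v b · b`, with `b = ∂_w f`, is half of `∂_v (b²)`. -/
theorem integral_dirDeriv_mul_mixed_mul (hf : SmoothPeriodic f) (v w : Plane) :
    ∫ y in unitCell, _root_.dirDeriv v f y
        * (_root_.dirDeriv v (_root_.dirDeriv w f) y * _root_.dirDeriv w f y)
      = -(1 / 2) * ∫ y in unitCell,
          _root_.dirDeriv v (_root_.dirDeriv v f) y * _root_.dirDeriv w f y ^ 2 := by
  have ha := hf.dirDeriv v
  have hb := hf.dirDeriv w
  have h := ha.integral_mul_dirDeriv (hb.pow 2) v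
  simp_rw [hb.dirDeriv_pow] at h
  have h2 : ∫ y in unitCell, _root_.dirDeriv v f y * ((2 : ℕ) * _root_.dirDeriv w f y ^ (2 - 1)
        * _root_.dirDeriv v (_root_.dirDeriv w f) y)
      = 2 * ∫ y in unitCell, _root_.dirDeriv v f y
        * (_root_.dirDeriv v (_root_.dirDeriv w f) y * _root_.dirDeriv w f y) := by
    rw [← integral_const_mul]
    congr 1; ext y; simp; ring
  rw [h2] at h
  linarith

/-- Moving one `∂_w` off `∂_w ∂_w f` gives `-2 ∫ ∂_v f · ∂_v ∂_w f · ∂_w f`, to which the previous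
identity applies. -/
theorem integral_sq_dirDeriv_mul (hf : SmoothPeriodic f) (v w : Plane) :
    ∫ y in unitCell, _root_.dirDeriv v f y ^ 2 * _root_.dirDeriv w (_root_.dirDeriv w f) y
      = ∫ y in unitCell,
          _root_.dirDeriv v (_root_.dirDeriv v f) y * _root_.dirDeriv w f y ^ 2 := by
  have ha := hf.dirDeriv v
  have hb := hf.dirDeriv w
  rw [(ha.pow 2).integral_mul_dirDeriv hb w]
  simp_rw [ha.dirDeriv_pow, hf.dirDeriv_comm w v]
  have h := hf.integral_dirDeriv_mul_mixed_mul v w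
  have h2 : ∫ y in unitCell, ((2 : ℕ) * _root_.dirDeriv v f y ^ (2 - 1)
        * _root_.dirDeriv v (_root_.dirDeriv w f) y) * _root_.dirDeriv w f y
      = 2 * ∫ y in unitCell, _root_.dirDeriv v f y
        * (_root_.dirDeriv v (_root_.dirDeriv w f) y * _root_.dirDeriv w f y) := by
    rw [← integral_const_mul]
    congr 1; ext y; simp; ring
  rw [h2, h]
  ring

/-- The Hessian determinant of `f` in the frame `v, w`. -/
noncomputable def hessDet (v w : Plane) (f : Plane → ℝ) : Plane → ℝ := fun y =>
  _root_.dirDeriv v (_root_.dirDeriv v f) y * _root_.dirDeriv w (_root_.dirDeriv w f) y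
    - _root_.dirDeriv v (_root_.dirDeriv w f) y * _root_.dirDeriv v (_root_.dirDeriv w f) y

/-- The determinant is the divergence-type expression `∂_w (f_vv f_w) - ∂_v (f_vw f_w)`, in which
the third derivatives cancel. Integrating by parts leaves `-∫ f_vv f_w² + ∫ f_v f_vw f_w`, and the
second integral is `-½ ∫ f_vv f_w²`. -/
theorem integral_mul_hessDet (hf : SmoothPeriodic f) (v w : Plane) :
    ∫ y in unitCell, f y * hessDet v w f y
      = -(3 / 2) * ∫ y in unitCell,
          _root_.dirDeriv v (_root_.dirDeriv v f) y * _root_.dirDeriv w f y ^ 2 := by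
  have ha := hf.dirDeriv v
  have hb := hf.dirDeriv w
  have hvv := ha.dirDeriv v
  have hvw := hb.dirDeriv v
  have hww := hb.dirDeriv w
  have h1 := hf.integral_mul_dirDeriv (hvv.mul hb) w
  have h2 := hf.integral_mul_dirDeriv (hvw.mul hb) v
  simp_rw [hvv.dirDeriv_mul hb] at h1
  simp_rw [hvw.dirDeriv_mul hb] at h2
  have hc : _root_.dirDeriv w (_root_.dirDeriv v (_root_.dirDeriv v f))
      = _root_.dirDeriv v (_root_.dirDeriv v (_root_.dirDeriv w f)) := by
    rw [ha.dirDeriv_comm w v, hf.dirDeriv_comm w v]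
  rw [hc] at h1
  have h3 := hf.integral_dirDeriv_mul_mixed_mul v w
  have h4 : ∫ y in unitCell, f y * hessDet v w f y
      = (∫ y in unitCell, f y * (_root_.dirDeriv v (_root_.dirDeriv v f) y
            * _root_.dirDeriv w (_root_.dirDeriv w f) y
          + _root_.dirDeriv v (_root_.dirDeriv v (_root_.dirDeriv w f)) y * _root_.dirDeriv w f y))
        - ∫ y in unitCell, f y * (_root_.dirDeriv v (_root_.dirDeriv w f) y
            * _root_.dirDeriv v (_root_.dirDeriv w f) y
          + _root_.dirDeriv v (_root_.dirDeriv v (_root_.dirDeriv w f)) y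
            * _root_.dirDeriv w f y) := by
    rw [← integral_sub]
    · congr 1; ext y; simp only [hessDet]; ring
    · exact (hf.mul ((hvv.mul hww).add ((hvw.dirDeriv v).mul hb))).integrable
    · exact (hf.mul ((hvw.mul hvw).add ((hvw.dirDeriv v).mul hb))).integrable
  have h5 : ∫ y in unitCell, _root_.dirDeriv w f y
        * (_root_.dirDeriv v (_root_.dirDeriv v f) y * _root_.dirDeriv w f y)
      = ∫ y in unitCell,
          _root_.dirDeriv v (_root_.dirDeriv v f) y * _root_.dirDeriv w f y ^ 2 := by
    congr 1; ext y; ring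
  rw [h4, h1, h2, h3, h5]
  ring

/-- The integrand is the Jacobian `∂_v (G(f_v)) f_ww - ∂_w (G(f_v)) f_vw` of `(G(f_v), f_w)`, a null
Lagrangian: after integration by parts the two third-derivative terms agree. -/
theorem integral_comp_dirDeriv_mul_hessDet (hf : SmoothPeriodic f) (v w : Plane) {F G : ℝ → ℝ}
    (hF : ContDiff ℝ ∞ F) (hG : ContDiff ℝ ∞ G) (hFG : ∀ t, HasDerivAt G (F t) t) :
    ∫ y in unitCell, F (_root_.dirDeriv v f y) * hessDet v w f y = 0 := by
  have ha := hf.dirDeriv v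
  have hb := hf.dirDeriv w
  have hvv := ha.dirDeriv v
  have hvw := hb.dirDeriv v
  have hww := hb.dirDeriv w
  have hGa := ha.comp hG
  have hFa := ha.comp hF
  have h1 := hGa.integral_mul_dirDeriv hww v
  have h2 := hGa.integral_mul_dirDeriv hvw w
  simp_rw [ha.dirDeriv_comp (hFG _), hf.dirDeriv_comm w v] at h1 h2
  rw [hb.dirDeriv_comm v w, h2] at h1
  have h4 : ∫ y in unitCell, F (_root_.dirDeriv v f y) * hessDet v w f y
      = (∫ y in unitCell, F (_root_.dirDeriv v f y) * _root_.dirDeriv v (_root_.dirDeriv v f) y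
          * _root_.dirDeriv w (_root_.dirDeriv w f) y)
        - ∫ y in unitCell, F (_root_.dirDeriv v f y) * _root_.dirDeriv v (_root_.dirDeriv w f) y
            * _root_.dirDeriv v (_root_.dirDeriv w f) y := by
    rw [← integral_sub]
    · congr 1; ext y; simp only [hessDet]; ring
    · exact ((hFa.mul hvv).mul hww).integrable
    · exact ((hFa.mul hvw).mul hvw).integrable
  rw [h4]
  linarith

end SmoothPeriodic

/-! ### Limits of products and of integrals -/

section LpConvergence

variable {α : Type*} [MeasurableSpace α] {μ : Measure α}

/-- Hölder's inequality applied to `FG - fg = (F - f)(G - g) + f (G - g) + (F - f) g`. -/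
theorem tendsto_eLpNorm_mul_sub {p q r : ℝ≥0∞} [HolderTriple p q r] (hr : 1 ≤ r)
    {F G : ℕ → α → ℝ} {f g : α → ℝ} (hF : ∀ n, AEStronglyMeasurable (F n) μ)
    (hG : ∀ n, AEStronglyMeasurable (G n) μ) (hf : MemLp f p μ) (hg : MemLp g q μ)
    (hFf : Tendsto (fun n => eLpNorm (F n - f) p μ) atTop (𝓝 0))
    (hGg : Tendsto (fun n => eLpNorm (G n - g) q μ) atTop (𝓝 0)) :
    Tendsto (fun n => eLpNorm ((fun x => F n x * G n x) - fun x => f x * g x) r μ)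
      atTop (𝓝 0) := by
  have hu : Tendsto (fun n => eLpNorm (F n - f) p μ * eLpNorm (G n - g) q μ
      + (eLpNorm f p μ * eLpNorm (G n - g) q μ + eLpNorm (F n - f) p μ * eLpNorm g q μ))
      atTop (𝓝 0) := by
    have h1 := ENNReal.Tendsto.mul hFf (Or.inr (by simp)) hGg (Or.inr (by simp))
    have h2 := ENNReal.Tendsto.const_mul hGg (Or.inr hf.2.ne)
    have h3 := ENNReal.Tendsto.mul_const hFf (Or.inr hg.2.ne)
    simpa using h1.add (h2.add h3)
  refine tendsto_of_tendsto_of_tendsto_of_le_of_le tendsto_const_nhds hu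
    (fun _ => zero_le) fun n => ?_
  have e : ((fun x => F n x * G n x) - fun x => f x * g x)
      = (F n - f) • (G n - g) + (f • (G n - g) + (F n - f) • g) := by
    ext x; simp; ring
  have mF := (hF n).sub hf.1
  have mG := (hG n).sub hg.1
  rw [e]
  refine (eLpNorm_add_le (mF.smul mG) ((hf.1.smul mG).add (mF.smul hg.1)) hr).trans ?_
  refine add_le_add (eLpNorm_smul_le_mul_eLpNorm mG mF) ?_
  refine (eLpNorm_add_le (hf.1.smul mG) (mF.smul hg.1) hr).trans ?_
  exact add_le_add (eLpNorm_smul_le_mul_eLpNorm mG hf.1) (eLpNorm_smul_le_mul_eLpNorm hg.1 mF)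

instance holderTriple_four_four_two : HolderTriple 4 4 2 :=
  ⟨by
    rw [show (4 : ℝ≥0∞) = 2 * 2 by norm_num, ENNReal.mul_inv (by simp) (by simp), ← mul_add,
      ENNReal.inv_two_add_inv_two, mul_one]⟩

theorem tendsto_integral_of_tendsto_eLpNorm_one {F : ℕ → α → ℝ} {f : α → ℝ}
    (hF : ∀ n, Integrable (F n) μ) (hf : Integrable f μ)
    (h : Tendsto (fun n => eLpNorm (F n - f) 1 μ) atTop (𝓝 0)) :
    Tendsto (fun n => ∫ x, F n x ∂μ) atTop (𝓝 (∫ x, f x ∂μ)) :=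
  tendsto_integral_of_L1' f hf.1 (Eventually.of_forall hF) h

theorem tendsto_integral_bounded_mul {F R : ℕ → α → ℝ} {C : ℝ} (hC : ∀ n x, |F n x| ≤ C)
    (hF : ∀ n, AEStronglyMeasurable (F n) μ) (hR : ∀ n, Integrable (R n) μ)
    (h : Tendsto (fun n => eLpNorm (R n) 1 μ) atTop (𝓝 0)) :
    Tendsto (fun n => ∫ x, F n x * R n x ∂μ) atTop (𝓝 0) := by
  have hi : ∀ n, Integrable (fun x => F n x * R n x) μ := fun n =>
    (hR n).bdd_mul (hF n) (Eventually.of_forall (hC n))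
  have := tendsto_integral_of_tendsto_eLpNorm_one hi (integrable_zero α ℝ μ) (by
    have hu : Tendsto (fun n => ENNReal.ofReal C * eLpNorm (R n) 1 μ) atTop (𝓝 0) := by
      simpa using ENNReal.Tendsto.const_mul h (Or.inr ENNReal.ofReal_ne_top)
    refine tendsto_of_tendsto_of_tendsto_of_le_of_le tendsto_const_nhds hu
      (fun _ => zero_le) fun n => ?_
    refine eLpNorm_le_mul_eLpNorm_of_ae_le_mul (Eventually.of_forall fun x => ?_) 1
    change |F n x * R n x - 0| ≤ C * |R n x|
    rw [sub_zero, abs_mul]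
    exact mul_le_mul_of_nonneg_right (hC n x) (abs_nonneg _))
  simpa using this

theorem eLpNorm_pow_eq_ofReal_integral {k : ℕ} (hk0 : k ≠ 0) (hk : Even k) {f : α → ℝ}
    (hf : Integrable (fun x => f x ^ k) μ) :
    eLpNorm f k μ ^ k = ENNReal.ofReal (∫ x, f x ^ k ∂μ) := by
  rw [eLpNorm_eq_lintegral_rpow_enorm_toReal (by simpa using hk0) (by simp),
    ofReal_integral_eq_lintegral_ofReal hf (Eventually.of_forall fun x => hk.pow_nonneg _),
    ← ENNReal.rpow_natCast, ← ENNReal.rpow_mul]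
  have : (1 / (k : ℝ≥0∞).toReal) * (k : ℝ) = 1 := by
    rw [ENNReal.toReal_natCast]; field_simp
  rw [this, ENNReal.rpow_one]
  refine lintegral_congr fun x => ?_
  rw [ENNReal.toReal_natCast, ENNReal.rpow_natCast, Real.enorm_eq_ofReal_abs,
    ← ENNReal.ofReal_pow (abs_nonneg _), hk.pow_abs]

end LpConvergence

/-- The functions `2 (1 - cos (δ t)) / δ² = (2 sin (δ t / 2) / δ)²` are dominated by `t²` and tend
to it as `δ → 0`, so dominated convergence along `δ = 1 / (k + 1)` applies. -/
theorem tendsto_integral_sq_mul_of_integral_one_sub_cos {α : Type*} [MeasurableSpace α]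
    {μ : Measure α} {a h : α → ℝ} (ha : AEStronglyMeasurable a μ)
    (hint : Integrable (fun x => a x ^ 2 * h x) μ) (hh : AEStronglyMeasurable h μ)
    (h0 : ∀ δ : ℝ, δ ≠ 0 → ∫ x, (1 - Real.cos (δ * a x)) * h x ∂μ = 0) :
    ∫ x, a x ^ 2 * h x ∂μ = 0 := by
  have hδ : ∀ k : ℕ, (1 / ((k : ℝ) + 1)) ≠ 0 := fun k => by positivity
  have hcos : ∀ δ t : ℝ, 1 - Real.cos (δ * t) = 2 * Real.sin (δ * (t / 2)) ^ 2 := fun δ t => by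
    rw [Real.sin_sq_eq_half_sub]; ring_nf
  have lim : Tendsto (fun k : ℕ => ∫ x, (2 * (1 - Real.cos (1 / ((k : ℝ) + 1) * a x))
      / (1 / ((k : ℝ) + 1)) ^ 2) * h x ∂μ) atTop (𝓝 (∫ x, a x ^ 2 * h x ∂μ)) := by
    refine tendsto_integral_of_dominated_convergence (fun x => ‖a x ^ 2 * h x‖) (fun k => ?_)
      hint.norm (fun k => Eventually.of_forall fun x => ?_) (Eventually.of_forall fun x => ?_)
    · refine AEStronglyMeasurable.mul ?_ hh
      exact (Continuous.comp_aestronglyMeasurable (g := fun t : ℝ =>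
        2 * (1 - Real.cos (1 / ((k : ℝ) + 1) * t)) / (1 / ((k : ℝ) + 1)) ^ 2) (by fun_prop) ha)
    · rw [norm_mul, norm_mul]
      refine mul_le_mul_of_nonneg_right ?_ (norm_nonneg _)
      rw [hcos, Real.norm_of_nonneg (by positivity), Real.norm_of_nonneg (by positivity),
        div_le_iff₀ (by positivity)]
      have := sq_le_sq.2 (Real.abs_sin_le_abs (x := 1 / ((k : ℝ) + 1) * (a x / 2)))
      nlinarith
    · refine Tendsto.mul_const _ ?_
      have hd : HasDerivAt (fun δ : ℝ => 2 * Real.sin (δ * (a x / 2))) (a x) 0 := by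
        have h1 : HasDerivAt (fun δ : ℝ => δ * (a x / 2)) (a x / 2) 0 := by
          simpa using (hasDerivAt_id (0 : ℝ)).mul_const (a x / 2)
        have := (h1.sin).const_mul 2
        simpa [mul_div_cancel₀] using this
      have h2 := hd.tendsto_slope_zero
      have h3 : Tendsto (fun k : ℕ => 1 / ((k : ℝ) + 1)) atTop (𝓝[≠] 0) :=
        tendsto_nhdsWithin_iff.2 ⟨tendsto_one_div_add_atTop_nhds_zero_nat,
          Eventually.of_forall hδ⟩
      refine ((h2.comp h3).pow 2).congr fun k => ?_
      simp only [Function.comp_apply, zero_add, zero_mul, Real.sin_zero, mul_zero, sub_zero,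
        smul_eq_mul, hcos]
      field_simp
  have hz : ∀ k : ℕ, ∫ x, (2 * (1 - Real.cos (1 / ((k : ℝ) + 1) * a x))
      / (1 / ((k : ℝ) + 1)) ^ 2) * h x ∂μ = 0 := fun k => by
    have : ∀ x, (2 * (1 - Real.cos (1 / ((k : ℝ) + 1) * a x)) / (1 / ((k : ℝ) + 1)) ^ 2) * h x
        = (2 / (1 / ((k : ℝ) + 1)) ^ 2) * ((1 - Real.cos (1 / ((k : ℝ) + 1) * a x)) * h x) :=
      fun x => by ring
    simp_rw [this]
    rw [integral_const_mul, h0 _ (hδ k), mul_zero]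
  simp_rw [hz] at lim
  exact (tendsto_nhds_unique lim tendsto_const_nhds)

/-! ### Weak derivatives through mollification -/

/-- Both candidates have the same mollifications, namely the derivatives of those of `f`, and
mollifications determine a function almost everywhere. -/
theorem IsWeakDeriv.ae_eq {v : Plane} {f g g' : Plane → ℝ} (h : IsWeakDeriv v f g)
    (h' : IsWeakDeriv v f g') : g =ᵐ[volume] g' := by
  filter_upwards [ae_tendsto_mollify h.2.1, ae_tendsto_mollify h'.2.1] with y h1 h2
  refine tendsto_nhds_unique h1 (h2.congr fun n => ?_)
  rw [← h.fderiv_mollify, ← h'.fderiv_mollify]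

theorem IsWeakDeriv.congr {v : Plane} {f f' g g' : Plane → ℝ} (h : IsWeakDeriv v f g)
    (hf : f =ᵐ[volume] f') (hg : g =ᵐ[volume] g') : IsWeakDeriv v f' g' := by
  refine ⟨h.1.congr hf, h.2.1.congr hg, fun φ hφ hc => ?_⟩
  have h1 : ∫ y, f' y * fderiv ℝ φ y v = ∫ y, f y * fderiv ℝ φ y v :=
    integral_congr_ae (by filter_upwards [hf] with y hy; rw [hy])
  have h2 : ∫ y, g' y * φ y = ∫ y, g y * φ y :=
    integral_congr_ae (by filter_upwards [hg] with y hy; rw [hy])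
  rw [h1, h2]
  exact h.2.2 φ hφ hc

theorem LocallyIntegrable.integrable_mul_of_hasCompactSupport {f φ : Plane → ℝ}
    (hf : LocallyIntegrable f) (hφ : Continuous φ) (hc : HasCompactSupport φ) :
    Integrable fun y => f y * φ y :=
  (hf.integrable_smul_left_of_hasCompactSupport hφ hc).congr
    (Eventually.of_forall fun y => by simp [mul_comm])

theorem IsWeakDeriv.linear_combination {v : Plane} {f g f' g' : Plane → ℝ}
    (h : IsWeakDeriv v f g) (h' : IsWeakDeriv v f' g') (a b : ℝ) :
    IsWeakDeriv v (fun y => a * f y + b * f' y) (fun y => a * g y + b * g' y) := by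
  refine ⟨(h.1.smul a).add (h'.1.smul b), (h.2.1.smul a).add (h'.2.1.smul b), fun φ hφ hc => ?_⟩
  have hd : Continuous fun y => fderiv ℝ φ y v :=
    (hφ.continuous_fderiv (by simp)).clm_apply continuous_const
  have hdc : HasCompactSupport fun y => fderiv ℝ φ y v := hc.fderiv_apply ℝ v
  simp_rw [add_mul, mul_assoc]
  rw [integral_add, integral_add]
  · simp_rw [integral_const_mul]
    rw [h.2.2 φ hφ hc, h'.2.2 φ hφ hc]
    ring
  · exact (LocallyIntegrable.integrable_mul_of_hasCompactSupport h.2.1 hφ.continuous hc).const_mul a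
  · exact (LocallyIntegrable.integrable_mul_of_hasCompactSupport h'.2.1 hφ.continuous hc).const_mul b
  · exact (LocallyIntegrable.integrable_mul_of_hasCompactSupport h.1 hd hdc).const_mul a
  · exact (LocallyIntegrable.integrable_mul_of_hasCompactSupport h'.1 hd hdc).const_mul b

theorem plane_eq_combination (v : Plane) :
    v = v 0 • EuclideanSpace.single 0 1 + v 1 • EuclideanSpace.single 1 1 := by
  ext i; fin_cases i <;> simp

theorem IsWeakDeriv.of_partials {f : Plane → ℝ} {g : Fin 2 → Plane → ℝ}
    (h : ∀ i, IsWeakPartial i f (g i)) (v : Plane) :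
    IsWeakDeriv v f fun y => v 0 * g 0 y + v 1 * g 1 y := by
  refine ⟨(h 0).1, ((h 0).2.1.smul (v 0)).add ((h 1).2.1.smul (v 1)), fun φ hφ hc => ?_⟩
  have hd : ∀ w, Continuous fun y => fderiv ℝ φ y w := fun w =>
    (hφ.continuous_fderiv (by simp)).clm_apply continuous_const
  have hdc : ∀ w, HasCompactSupport fun y => fderiv ℝ φ y w := fun w => hc.fderiv_apply ℝ w
  have h1 : ∀ y, f y * fderiv ℝ φ y v
      = v 0 * (f y * fderiv ℝ φ y (EuclideanSpace.single 0 1))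
        + v 1 * (f y * fderiv ℝ φ y (EuclideanSpace.single 1 1)) := fun y => by
    conv_lhs => rw [plane_eq_combination v]
    simp only [map_add, map_smul, smul_eq_mul]
    ring
  simp_rw [h1, add_mul, mul_assoc]
  rw [integral_add, integral_add]
  · simp_rw [integral_const_mul]
    rw [(h 0).2.2 φ hφ hc, (h 1).2.2 φ hφ hc]
    ring
  · exact (LocallyIntegrable.integrable_mul_of_hasCompactSupport (h 0).2.1
      hφ.continuous hc).const_mul _
  · exact (LocallyIntegrable.integrable_mul_of_hasCompactSupport (h 1).2.1
      hφ.continuous hc).const_mul _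
  · exact (LocallyIntegrable.integrable_mul_of_hasCompactSupport (h 0).1 (hd _)
      (hdc _)).const_mul _
  · exact (LocallyIntegrable.integrable_mul_of_hasCompactSupport (h 0).1 (hd _)
      (hdc _)).const_mul _

theorem CellPeriodic.smoothPeriodic_mollify {f : Plane → ℝ} (hf : CellPeriodic f)
    (hi : LocallyIntegrable f) (n : ℕ) : SmoothPeriodic (_root_.mollify n f) :=
  ⟨contDiff_mollify n hi, hf.mollify n⟩

theorem IsWeakDeriv.dirDeriv_mollify {v : Plane} {f g : Plane → ℝ} (h : IsWeakDeriv v f g)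
    (n : ℕ) : dirDeriv v (mollify n f) = mollify n g :=
  funext fun y => h.fderiv_mollify n y

/-- The weak derivative of an a.e. periodic function is a.e. periodic. -/
theorem IsWeakDeriv.ae_periodic {v : Plane} {f g : Plane → ℝ} (h : IsWeakDeriv v f g)
    (hf : CellPeriodic f) (i : Fin 2) :
    (fun y => g (y + EuclideanSpace.single i (1 : ℝ))) =ᵐ[volume] g := by
  have h1 := ae_tendsto_mollify h.2.1
  have h2 := (measurePreserving_add_right (volume : Measure Plane)
    (EuclideanSpace.single i (1 : ℝ))).quasiMeasurePreserving.ae h1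
  filter_upwards [h1, h2] with y hy1 hy2
  refine tendsto_nhds_unique (hy2.congr fun n => ?_) hy1
  rw [← h.dirDeriv_mollify]
  exact ((hf.smoothPeriodic_mollify h.1 n).dirDeriv v).periodic i y

theorem IsWeakDeriv.ae_eq_periodization {v : Plane} {f g : Plane → ℝ} (h : IsWeakDeriv v f g)
    (hf : CellPeriodic f) : g =ᵐ[volume] periodization g :=
  (periodization_ae_eq (h.ae_periodic hf)).symm

theorem tendsto_eLpNorm_sub_sub {p : ℝ≥0∞} (hp : 1 ≤ p) {α : Type*} [MeasurableSpace α]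
    {μ : Measure α} {F : ℕ → α → ℝ} {f : α → ℝ} (hF : ∀ n, AEStronglyMeasurable (F n) μ)
    (hf : AEStronglyMeasurable f μ)
    (h : Tendsto (fun n => eLpNorm (F n - f) p μ) atTop (𝓝 0)) {ε : ℝ≥0∞} (hε : ε ≠ 0) :
    ∃ N, ∀ n ≥ N, ∀ m ≥ N, eLpNorm (fun x => F n x - F m x) p μ ≤ ε := by
  have h2 : (0 : ℝ≥0∞) < ε / 2 := ENNReal.half_pos hε
  obtain ⟨N, hN⟩ := eventually_atTop.1 (ENNReal.tendsto_nhds_zero.1 h _ h2)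
  refine ⟨N, fun n hn m hm => ?_⟩
  have e : (fun x => F n x - F m x) = (F n - f) - (F m - f) := by ext x; simp
  rw [e]
  calc _ ≤ eLpNorm (F n - f) p μ + eLpNorm (F m - f) p μ :=
        eLpNorm_sub_le ((hF n).sub hf) ((hF m).sub hf) hp
    _ ≤ ε / 2 + ε / 2 := add_le_add (hN n hn) (hN m hm)
    _ = ε := ENNReal.add_halves ε

theorem integral_abs_le_of_eLpNorm_two_le {f : Plane → ℝ} (hf : SmoothPeriodic f) {ε : ℝ}
    (hε : 0 ≤ ε) (h : eLpNorm f 2 cellMeasure ≤ ENNReal.ofReal ε) :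
    ∫ y in unitCell, |f y| ≤ ε := by
  have h1 := eLpNorm_le_eLpNorm_of_exponent_le (p := 1) (q := 2) (by norm_num)
    hf.continuous.aestronglyMeasurable (μ := cellMeasure)
  have h2 := h1.trans h
  rw [eLpNorm_one_eq_lintegral_enorm, ← ofReal_integral_norm_eq_lintegral_enorm hf.integrable] at h2
  exact (ENNReal.ofReal_le_ofReal_iff hε).1 h2

/-! ### Uniform convergence of mollifications and `L⁴` convergence of gradients -/

/-- The mollifications of a periodic `H²` function are uniformly Cauchy. -/
theorem mollify_uniformCauchy {ψ g0 g1 h01 : Plane → ℝ}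
    (d0 : IsWeakPartial 0 ψ g0) (d1 : IsWeakPartial 1 ψ g1) (d01 : IsWeakPartial 1 g0 h01)
    (pψ : CellPeriodic ψ) (p0 : CellPeriodic g0) (p1 : CellPeriodic g1) (p01 : CellPeriodic h01)
    (mψ : MemLp ψ 2 cellMeasure) (m0 : MemLp g0 2 cellMeasure) (m1 : MemLp g1 2 cellMeasure)
    (m01 : MemLp h01 2 cellMeasure) {ε : ℝ} (hε : 0 < ε) :
    ∃ N, ∀ n ≥ N, ∀ m ≥ N, ∀ y, |mollify n ψ y - mollify m ψ y| ≤ ε := by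
  have cauchy : ∀ f : Plane → ℝ, CellPeriodic f → LocallyIntegrable f → MemLp f 2 cellMeasure →
      ∃ N, ∀ n ≥ N, ∀ m ≥ N, ∫ y in unitCell, |mollify n f y - mollify m f y| ≤ ε / 4 := by
    intro f pf lf mf
    obtain ⟨N, hN⟩ := tendsto_eLpNorm_sub_sub (by norm_num)
      (fun n => (contDiff_mollify n lf).continuous.aestronglyMeasurable) mf.1
      (tendsto_eLpNorm_mollify_sub pf lf mf) (ε := ENNReal.ofReal (ε / 4)) (by simpa using hε)
    exact ⟨N, fun n hn m hm => integral_abs_le_of_eLpNorm_two_le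
      ((pf.smoothPeriodic_mollify lf n).sub (pf.smoothPeriodic_mollify lf m)) (by positivity)
      (hN n hn m hm)⟩
  obtain ⟨N1, hN1⟩ := cauchy ψ pψ d0.1 mψ
  obtain ⟨N2, hN2⟩ := cauchy g0 p0 d0.2.1 m0
  obtain ⟨N3, hN3⟩ := cauchy g1 p1 d1.2.1 m1
  obtain ⟨N4, hN4⟩ := cauchy h01 p01 d01.2.1 m01
  refine ⟨max (max N1 N2) (max N3 N4), fun n hn m hm y => ?_⟩
  simp only [ge_iff_le, max_le_iff] at hn hm
  have sψ := pψ.smoothPeriodic_mollify d0.1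
  have s0 := p0.smoothPeriodic_mollify d0.2.1
  have s1 := p1.smoothPeriodic_mollify d1.2.1
  have s01 := p01.smoothPeriodic_mollify d01.2.1
  have key := ((sψ n).sub (sψ m)).abs_le_integral y
  have e0 : dirDeriv (EuclideanSpace.single 0 1) (fun y => mollify n ψ y - mollify m ψ y)
      = fun y => mollify n g0 y - mollify m g0 y := by
    ext y; rw [(sψ n).dirDeriv_sub (sψ m), d0.dirDeriv_mollify, d0.dirDeriv_mollify]
  have e1 : dirDeriv (EuclideanSpace.single 1 1) (fun y => mollify n ψ y - mollify m ψ y)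
      = fun y => mollify n g1 y - mollify m g1 y := by
    ext y; rw [(sψ n).dirDeriv_sub (sψ m), d1.dirDeriv_mollify, d1.dirDeriv_mollify]
  have e01 : dirDeriv (EuclideanSpace.single 1 1) (fun y => mollify n g0 y - mollify m g0 y)
      = fun y => mollify n h01 y - mollify m h01 y := by
    ext y; rw [(s0 n).dirDeriv_sub (s0 m), d01.dirDeriv_mollify, d01.dirDeriv_mollify]
  rw [e0, e1, e01] at key
  have i1 := ((sψ n).sub (sψ m)).integrable.abs
  have i2 := ((s0 n).sub (s0 m)).integrable.abs
  have i3 := ((s1 n).sub (s1 m)).integrable.abs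
  have i4 := ((s01 n).sub (s01 m)).integrable.abs
  beta_reduce at key
  rw [integral_add (f := fun y => |mollify n ψ y - mollify m ψ y|
      + |mollify n g1 y - mollify m g1 y|)
      (g := fun y => |mollify n g0 y - mollify m g0 y| + |mollify n h01 y - mollify m h01 y|)
      (i1.add i3) (i2.add i4), integral_add i1 i3,
    integral_add i2 i4] at key
  have := hN1 n hn.1.1 m hm.1.1
  have := hN2 n hn.1.2 m hm.1.2
  have := hN3 n hn.2.1 m hm.2.1
  have := hN4 n hn.2.2 m hm.2.2
  linarith

/-- The mollified gradients of a periodic `H²` function converge in `L⁴`. -/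
theorem tendsto_eLpNorm_four_mollify {v : Plane} {ψ a h : Plane → ℝ}
    (da : IsWeakDeriv v ψ a) (dh : IsWeakDeriv v a h)
    (pψ : CellPeriodic ψ) (ph : CellPeriodic h) (mh : MemLp h 2 cellMeasure)
    (hc : ∀ ε > (0 : ℝ), ∃ N, ∀ n ≥ N, ∀ m ≥ N, ∀ y, |mollify n ψ y - mollify m ψ y| ≤ ε) :
    Tendsto (fun n => eLpNorm (mollify n a - a) 4 cellMeasure) atTop (𝓝 0) := by
  rw [ENNReal.tendsto_nhds_zero]
  intro η hη
  obtain ⟨δ, hδ0, hδη⟩ : ∃ δ : ℝ, 0 < δ ∧ ENNReal.ofReal δ ≤ η := by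
    rcases eq_or_ne η ⊤ with rfl | ht
    · exact ⟨1, one_pos, le_top⟩
    · exact ⟨η.toReal, ENNReal.toReal_pos hη.ne' ht, (ENNReal.ofReal_toReal ht).le⟩
  -- Chosen so that the interpolation bound becomes `9 (δ² / 3)² · 1 = δ⁴`; the factor 1 bounds the
  -- second derivatives of the difference.
  obtain ⟨N, hN⟩ := hc (δ ^ 2 / 3) (by positivity)
  obtain ⟨N', hN'⟩ := tendsto_eLpNorm_sub_sub (by norm_num)
      (fun n => (contDiff_mollify n dh.2.1).continuous.aestronglyMeasurable) mh.1
      (tendsto_eLpNorm_mollify_sub ph dh.2.1 mh) (ε := 1) (by simp)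
  have sψ := pψ.smoothPeriodic_mollify da.1
  have bound : ∀ n ≥ max N N', ∀ m ≥ max N N',
      eLpNorm (mollify n a - mollify m a) 4 cellMeasure ≤ ENNReal.ofReal δ := by
    intro n hn m hm
    simp only [ge_iff_le, max_le_iff] at hn hm
    have sd := (sψ n).sub (sψ m)
    have ea : dirDeriv v (fun y => mollify n ψ y - mollify m ψ y)
        = fun y => mollify n a y - mollify m a y := by
      ext y; rw [(sψ n).dirDeriv_sub (sψ m), da.dirDeriv_mollify, da.dirDeriv_mollify]
    have san : ∀ k, SmoothPeriodic (mollify k a) := fun k => by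
      rw [← da.dirDeriv_mollify]; exact (sψ k).dirDeriv v
    have eh : dirDeriv v (fun y => mollify n a y - mollify m a y)
        = fun y => mollify n h y - mollify m h y := by
      ext y; rw [(san n).dirDeriv_sub (san m), dh.dirDeriv_mollify, dh.dirDeriv_mollify]
    have sh : SmoothPeriodic fun y => mollify n h y - mollify m h y := by
      rw [← eh, ← ea]; exact (sd.dirDeriv v).dirDeriv v
    have key := sd.integral_dirDeriv_pow_four_le v (hN n hn.1 m hm.1)
    rw [ea, eh] at key
    have h2 : ∫ y in unitCell, (mollify n h y - mollify m h y) ^ 2 ≤ 1 := by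
      have h3 := hN' n hn.2 m hm.2
      have h4 := eLpNorm_pow_eq_ofReal_integral (μ := cellMeasure) two_ne_zero even_two
        (sh.pow 2).integrable
      rw [← ENNReal.ofReal_le_one, ← h4]
      exact pow_le_one₀ zero_le (by exact_mod_cast h3)
    have h5 : ∫ y in unitCell, (mollify n a y - mollify m a y) ^ 4 ≤ δ ^ 4 := by
      refine key.trans ((mul_le_mul_of_nonneg_left h2 (by positivity)).trans (le_of_eq ?_))
      ring
    have h6 := eLpNorm_pow_eq_ofReal_integral (μ := cellMeasure) (k := 4) (by norm_num)
      (by decide) ((((san n).sub (san m)).pow 4).integrable)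
    have h7 : eLpNorm (fun y => mollify n a y - mollify m a y) (4 : ℕ) cellMeasure ^ 4
        ≤ ENNReal.ofReal δ ^ 4 := by
      rw [h6, ← ENNReal.ofReal_pow hδ0.le]
      exact ENNReal.ofReal_le_ofReal h5
    exact_mod_cast (ENNReal.pow_le_pow_left_iff (by norm_num)).1 h7
  refine eventually_atTop.2 ⟨max N N', fun n hn => le_trans ?_ hδη⟩
  have meas : ∀ k, AEStronglyMeasurable (mollify k a) cellMeasure := fun k =>
    (contDiff_mollify k da.2.1).continuous.aestronglyMeasurable
  -- Fatou in `m`: the Cauchy estimate passes to the almost everywhere limit `a`, which is not yet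
  -- known to lie in `L⁴`.
  refine (Lp.eLpNorm_lim_le_liminf_eLpNorm (f := fun m => mollify n a - mollify m a)
    (fun m => (meas n).sub (meas m)) (mollify n a - a) ?_).trans ?_
  · filter_upwards [ae_restrict_of_ae (ae_tendsto_mollify da.2.1)] with y hy
    exact hy.const_sub _
  · refine liminf_le_of_frequently_le' (Eventually.frequently ?_)
    exact eventually_atTop.2 ⟨max N N', fun m hm => bound n hn m hm⟩

/-! ### Vanishing of the derivative orthogonal to `T` -/

/-- A periodic `H²` function whose perturbed Hessian determinant vanishes, in the frame `v, w`, is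
constant in the direction `w`. -/
theorem weakDeriv_eq_zero_of_det_eq_zero {c : ℝ} (hc : c ≠ 0) {v w : Plane}
    {ψ a b hvv hvw hww : Plane → ℝ}
    (da : IsWeakDeriv v ψ a) (db : IsWeakDeriv w ψ b) (dvv : IsWeakDeriv v a hvv)
    (dvw : IsWeakDeriv v b hvw) (dww : IsWeakDeriv w b hww)
    (pψ : CellPeriodic ψ) (pa : CellPeriodic a) (pb : CellPeriodic b)
    (pvv : CellPeriodic hvv) (pvw : CellPeriodic hvw) (pww : CellPeriodic hww)
    (ma : MemLp a 2 cellMeasure)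
    (mb : MemLp b 2 cellMeasure) (mvv : MemLp hvv 2 cellMeasure) (mvw : MemLp hvw 2 cellMeasure)
    (mww : MemLp hww 2 cellMeasure)
    (hcauchy : ∀ ε > (0 : ℝ), ∃ N, ∀ n ≥ N, ∀ m ≥ N, ∀ y,
      |mollify n ψ y - mollify m ψ y| ≤ ε)
    (hdet : ∀ᵐ y : Plane, hvv y * hww y - hvw y * hvw y = -c * hww y) :
    b =ᵐ[volume] 0 := by
  have sψ := pψ.smoothPeriodic_mollify da.1
  have sa := pa.smoothPeriodic_mollify da.2.1
  have sb := pb.smoothPeriodic_mollify db.2.1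
  have svv := pvv.smoothPeriodic_mollify dvv.2.1
  have svw := pvw.smoothPeriodic_mollify dvw.2.1
  have sww := pww.smoothPeriodic_mollify dww.2.1
  have as : ∀ {f : Plane → ℝ}, SmoothPeriodic f → AEStronglyMeasurable f cellMeasure :=
    fun h => h.continuous.aestronglyMeasurable
  have La := tendsto_eLpNorm_mollify_sub pa da.2.1 ma
  have Lb := tendsto_eLpNorm_mollify_sub pb db.2.1 mb
  have Lvv := tendsto_eLpNorm_mollify_sub pvv dvv.2.1 mvv
  have Lvw := tendsto_eLpNorm_mollify_sub pvw dvw.2.1 mvw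
  have Lww := tendsto_eLpNorm_mollify_sub pww dww.2.1 mww
  have La4 := tendsto_eLpNorm_four_mollify da dvv pψ pvv mvv hcauchy
  have Lb4 := tendsto_eLpNorm_four_mollify db dww pψ pww mww hcauchy
  -- The limit lies in `L⁴` because it is at finite `L⁴` distance from one of its bounded
  -- mollifications.
  have mem4 : ∀ {f : Plane → ℝ}, AEStronglyMeasurable f cellMeasure →
      (∀ n, SmoothPeriodic (mollify n f)) →
      Tendsto (fun n => eLpNorm (mollify n f - f) 4 cellMeasure) atTop (𝓝 0) →
      MemLp f 4 cellMeasure := by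
    intro f mf sf hf
    obtain ⟨n, hn⟩ := (hf.eventually (gt_mem_nhds ENNReal.zero_lt_top)).exists
    have h1 : MemLp (mollify n f - f) 4 cellMeasure := ⟨(as (sf n)).sub mf, hn⟩
    have := ((sf n).memLp 4).sub h1
    simpa using this
  have ma4 := mem4 ma.1 sa La4
  have mb4 := mem4 mb.1 sb Lb4
  -- squares of the gradient components converge in `L²`
  have La2 := tendsto_eLpNorm_mul_sub (r := 2) (by norm_num) (fun n => as (sa n))
    (fun n => as (sa n)) ma4 ma4 La4 La4
  have Lb2 := tendsto_eLpNorm_mul_sub (r := 2) (by norm_num) (fun n => as (sb n))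
    (fun n => as (sb n)) mb4 mb4 Lb4 Lb4
  have ma2 : MemLp (fun y => a y * a y) 2 cellMeasure := ma4.mul' ma4
  have mb2 : MemLp (fun y => b y * b y) 2 cellMeasure := mb4.mul' mb4
  -- a product of two `L²`-convergent sequences has convergent integrals
  have prod : ∀ {F G : ℕ → Plane → ℝ} {f g : Plane → ℝ}, (∀ n, SmoothPeriodic (F n)) →
      (∀ n, SmoothPeriodic (G n)) → MemLp f 2 cellMeasure → MemLp g 2 cellMeasure →
      Tendsto (fun n => eLpNorm (F n - f) 2 cellMeasure) atTop (𝓝 0) →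
      Tendsto (fun n => eLpNorm (G n - g) 2 cellMeasure) atTop (𝓝 0) →
      Tendsto (fun n => ∫ y in unitCell, F n y * G n y) atTop
        (𝓝 (∫ y in unitCell, f y * g y)) := by
    intro F G f g sF sG mf mg hF hG
    exact tendsto_integral_of_tendsto_eLpNorm_one (fun n => ((sF n).mul (sG n)).integrable)
      (mf.integrable_mul mg) (tendsto_eLpNorm_mul_sub (p := 2) (q := 2) (r := 1) le_rfl
        (fun n => as (sF n)) (fun n => as (sG n)) mf mg hF hG)
  -- the residual of the equation for the mollified function tends to zero in `L¹`
  set R : ℕ → Plane → ℝ := fun n y =>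
    SmoothPeriodic.hessDet v w (mollify n ψ) y + c * mollify n hww y with hR
  have hdetn : ∀ n, SmoothPeriodic.hessDet v w (mollify n ψ) = fun y =>
      mollify n hvv y * mollify n hww y - mollify n hvw y * mollify n hvw y := fun n => by
    ext y
    simp only [SmoothPeriodic.hessDet, da.dirDeriv_mollify, db.dirDeriv_mollify,
      dvv.dirDeriv_mollify, dvw.dirDeriv_mollify, dww.dirDeriv_mollify]
  have sdet : ∀ n, SmoothPeriodic (SmoothPeriodic.hessDet v w (mollify n ψ)) := fun n => by
    rw [hdetn]; exact ((svv n).mul (sww n)).sub ((svw n).mul (svw n))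
  have scww : ∀ n, SmoothPeriodic fun y => c * mollify n hww y := fun n =>
    (sww n).comp (F := fun t => c * t) (contDiff_const.mul contDiff_id)
  have sR : ∀ n, SmoothPeriodic (R n) := fun n => (sdet n).add (scww n)
  have LR : Tendsto (fun n => eLpNorm (R n) 1 cellMeasure) atTop (𝓝 0) := by
    have h1 := tendsto_eLpNorm_mul_sub (p := 2) (q := 2) (r := 1) le_rfl (fun n => as (svv n))
      (fun n => as (sww n)) mvv mww Lvv Lww
    have h2 := tendsto_eLpNorm_mul_sub (p := 2) (q := 2) (r := 1) le_rfl (fun n => as (svw n))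
      (fun n => as (svw n)) mvw mvw Lvw Lvw
    have h3 : Tendsto (fun n => ‖c‖ₑ * eLpNorm (mollify n hww - hww) 2 cellMeasure)
        atTop (𝓝 0) := by
      simpa using ENNReal.Tendsto.const_mul Lww (Or.inr enorm_ne_top)
    have hu := (h1.add h2).add h3
    simp only [add_zero] at hu
    refine tendsto_of_tendsto_of_tendsto_of_le_of_le tendsto_const_nhds hu
      (fun _ => zero_le) fun n => ?_
    have e : R n =ᵐ[cellMeasure]
        (((fun x => mollify n hvv x * mollify n hww x) - fun x => hvv x * hww x)
          - ((fun x => mollify n hvw x * mollify n hvw x) - fun x => hvw x * hvw x))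
          + c • (mollify n hww - hww) := by
      filter_upwards [ae_restrict_of_ae hdet] with y hy
      simp only [hR, hdetn, Pi.add_apply, Pi.sub_apply, Pi.smul_apply, smul_eq_mul]
      linarith
    have m1 := (as ((svv n).mul (sww n))).sub (mvv.1.mul mww.1)
    have m2 := (as ((svw n).mul (svw n))).sub (mvw.1.mul mvw.1)
    have m3 := (as (sww n)).sub mww.1
    rw [eLpNorm_congr_ae e]
    refine (eLpNorm_add_le (m1.sub m2) (m3.const_smul c) le_rfl).trans ?_
    refine add_le_add (eLpNorm_sub_le m1 m2 le_rfl) ?_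
    rw [eLpNorm_const_smul]
    gcongr
    exact eLpNorm_le_eLpNorm_of_exponent_le (by norm_num) m3
  -- the mollified functions are uniformly bounded
  obtain ⟨M, hM⟩ : ∃ (M : ℝ), ∃ N, ∀ n ≥ N, ∀ y, |mollify n ψ y| ≤ M := by
    obtain ⟨N, hN⟩ := hcauchy 1 one_pos
    obtain ⟨C, hC⟩ := (sψ N).exists_bound
    refine ⟨C + 1, N, fun n hn y => ?_⟩
    have h1 := hN n hn N le_rfl y
    have h2 := abs_sub_abs_le_abs_sub (mollify n ψ y) (mollify N ψ y)
    have h3 := hC y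
    linarith
  obtain ⟨N, hM⟩ := hM
  -- testing with the cosine of the first gradient component
  have cos_test : ∀ δ : ℝ, δ ≠ 0 →
      ∫ y in unitCell, (1 - Real.cos (δ * a y)) * hww y = 0 := by
    intro δ hδ
    have cF : ContDiff ℝ ∞ fun t : ℝ => 1 - Real.cos (δ * t) :=
      contDiff_const.sub (Real.contDiff_cos.comp (contDiff_const.mul contDiff_id))
    have cG : ContDiff ℝ ∞ fun t : ℝ => t - Real.sin (δ * t) / δ :=
      contDiff_id.sub ((Real.contDiff_sin.comp (contDiff_const.mul contDiff_id)).div_const δ)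
    have dG : ∀ t : ℝ, HasDerivAt (fun t : ℝ => t - Real.sin (δ * t) / δ)
        (1 - Real.cos (δ * t)) t := fun t => by
      have h1 : HasDerivAt (fun t : ℝ => δ * t) δ t := by
        simpa using (hasDerivAt_id t).const_mul δ
      have h2 := (hasDerivAt_id t).sub (h1.sin.div_const δ)
      rwa [mul_div_cancel_right₀ _ hδ] at h2
    have sF : ∀ n, SmoothPeriodic fun y => 1 - Real.cos (δ * mollify n a y) := fun n =>
      (sa n).comp cF
    -- The determinant part of `R n` integrates to zero against a function of `∂_v` of the mollified
    -- `ψ`, so only the linear term remains.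
    have h0 : ∀ n, ∫ y in unitCell, (1 - Real.cos (δ * mollify n a y)) * R n y
        = c * ∫ y in unitCell, (1 - Real.cos (δ * mollify n a y)) * mollify n hww y := fun n => by
      have h1 := (sψ n).integral_comp_dirDeriv_mul_hessDet v w cF cG dG
      rw [da.dirDeriv_mollify] at h1
      simp only [hR, mul_add]
      rw [integral_add ((sF n).mul (sdet n)).integrable ((sF n).mul (scww n)).integrable, h1,
        zero_add, ← integral_const_mul]
      congr 1; ext y; ring
    have t1 : Tendsto (fun n => ∫ y in unitCell, (1 - Real.cos (δ * mollify n a y)) * R n y)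
        atTop (𝓝 0) := by
      refine tendsto_integral_bounded_mul (C := 2) (fun n y => ?_) (fun n => as (sF n))
        (fun n => (sR n).integrable) LR
      have := Real.cos_le_one (δ * mollify n a y)
      have := Real.neg_one_le_cos (δ * mollify n a y)
      rw [abs_le]; constructor <;> linarith
    have Lcos : Tendsto (fun n => eLpNorm ((fun y => 1 - Real.cos (δ * mollify n a y))
        - fun y => 1 - Real.cos (δ * a y)) 2 cellMeasure) atTop (𝓝 0) := by
      have hu : Tendsto (fun n => ENNReal.ofReal |δ| * eLpNorm (mollify n a - a) 2 cellMeasure)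
          atTop (𝓝 0) := by
        simpa using ENNReal.Tendsto.const_mul La (Or.inr ENNReal.ofReal_ne_top)
      refine tendsto_of_tendsto_of_tendsto_of_le_of_le tendsto_const_nhds hu
        (fun _ => zero_le) fun n => ?_
      refine eLpNorm_le_mul_eLpNorm_of_ae_le_mul (Eventually.of_forall fun y => ?_) 2
      simp only [Pi.sub_apply, Real.norm_eq_abs]
      rw [← abs_mul, mul_sub, abs_sub_comm (δ * _)]
      convert Real.abs_cos_sub_cos_le (δ * a y) (δ * mollify n a y) using 2
      ring
    have mcos : MemLp (fun y => 1 - Real.cos (δ * a y)) 2 cellMeasure := by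
      refine MemLp.of_bound (cF.continuous.comp_aestronglyMeasurable ma.1) 2
        (Eventually.of_forall fun y => ?_)
      have := Real.cos_le_one (δ * a y)
      have := Real.neg_one_le_cos (δ * a y)
      rw [Real.norm_eq_abs, abs_le]; constructor <;> linarith
    have t2 := (prod sF sww mcos mww Lcos Lww).const_mul c
    simp only [h0] at t1
    have := tendsto_nhds_unique t2 t1
    exact (mul_eq_zero.1 this).resolve_left hc
  have asq : ∫ y in unitCell, a y ^ 2 * hww y = 0 :=
    tendsto_integral_sq_mul_of_integral_one_sub_cos ma.1
      ((ma2.integrable_mul mww).congr (Eventually.of_forall fun y => by simp [sq])) mww.1 cos_test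
  -- hence the cubic term vanishes
  have sa2 : ∀ n, SmoothPeriodic fun y => mollify n a y * mollify n a y := fun n =>
    (sa n).mul (sa n)
  have sb2 : ∀ n, SmoothPeriodic fun y => mollify n b y * mollify n b y := fun n =>
    (sb n).mul (sb n)
  have t3 := prod sa2 sww ma2 mww La2 Lww
  have t4 := prod svv sb2 mvv mb2 Lvv Lb2
  have t34 : ∀ n, ∫ y in unitCell, mollify n a y * mollify n a y * mollify n hww y
      = ∫ y in unitCell, mollify n hvv y * (mollify n b y * mollify n b y) := fun n => by
    have := (sψ n).integral_sq_dirDeriv_mul v w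
    simpa only [da.dirDeriv_mollify, db.dirDeriv_mollify, dvv.dirDeriv_mollify,
      dww.dirDeriv_mollify, sq] using this
  simp only [t34] at t3
  have cubic : ∫ y in unitCell, hvv y * (b y * b y) = 0 := by
    rw [← tendsto_nhds_unique t3 t4, ← asq]
    simp only [sq]
  rw [cubic] at t4
  have t5 := prod sb sb mb mb Lb Lb
  -- The index is shifted because the uniform bound `M` holds only from `N` on.
  have t6 : Tendsto (fun n => ∫ y in unitCell, mollify (n + N) ψ y * R (n + N) y)
      atTop (𝓝 0) :=
    tendsto_integral_bounded_mul (fun n y => hM (n + N) (by omega) y) (fun n => as (sψ _))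
      (fun n => (sR _).integrable) (LR.comp (tendsto_add_atTop_nat N))
  have h6 : ∀ n, ∫ y in unitCell, mollify n ψ y * R n y
      = -(3 / 2) * (∫ y in unitCell, mollify n hvv y * (mollify n b y * mollify n b y))
        - c * ∫ y in unitCell, mollify n b y * mollify n b y := fun n => by
    have h1 := (sψ n).integral_mul_hessDet v w
    have h2 := (sψ n).integral_mul_dirDeriv (sb n) w
    simp only [da.dirDeriv_mollify, db.dirDeriv_mollify, dvv.dirDeriv_mollify,
      dww.dirDeriv_mollify, sq] at h1 h2
    simp only [hR, mul_add]
    rw [integral_add ((sψ n).mul (sdet n)).integrable ((sψ n).mul (scww n)).integrable, h1]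
    have h3 : ∫ y in unitCell, mollify n ψ y * (c * mollify n hww y)
        = c * ∫ y in unitCell, mollify n ψ y * mollify n hww y := by
      rw [← integral_const_mul]; congr 1; ext y; ring
    rw [h3, h2]; ring
  simp only [h6] at t6
  have t7 := (((t4.const_mul (-(3 / 2))).sub (t5.const_mul c)).comp (tendsto_add_atTop_nat N))
  have h8 := tendsto_nhds_unique t6 t7
  have h9 : ∫ y in unitCell, b y * b y = 0 := by
    have : c * ∫ y in unitCell, b y * b y = 0 := by linarith
    exact (mul_eq_zero.1 this).resolve_left hc
  rw [integral_eq_zero_iff_of_nonneg (fun y => mul_self_nonneg _) (mb.integrable_mul mb)] at h9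
  exact pb.ae_zero_of_cell (h9.mono fun y hy => mul_self_eq_zero.1 hy)

/-! ### The continuous representative and the periods of its profile -/

theorem exists_continuous_limit_mollify {ψ : Plane → ℝ}
    (hi : LocallyIntegrable ψ)
    (hcauchy : ∀ ε > (0 : ℝ), ∃ N, ∀ n ≥ N, ∀ m ≥ N, ∀ y,
      |mollify n ψ y - mollify m ψ y| ≤ ε) :
    ∃ F : Plane → ℝ, Continuous F ∧ F =ᵐ[volume] ψ ∧
      ∀ y, Tendsto (fun n => mollify n ψ y) atTop (𝓝 (F y)) := by
  have hu : UniformCauchySeqOn (fun n => mollify n ψ) atTop Set.univ := by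
    rw [Metric.uniformCauchySeqOn_iff]
    intro ε hε
    obtain ⟨N, hN⟩ := hcauchy (ε / 2) (by positivity)
    refine ⟨N, fun n hn m hm y _ => ?_⟩
    rw [Real.dist_eq]
    exact (hN n hn m hm y).trans_lt (by linarith)
  choose F hF using fun y => cauchySeq_tendsto_of_complete (hu.cauchySeq (Set.mem_univ y))
  have ht := hu.tendstoUniformlyOn_of_tendsto fun y _ => hF y
  refine ⟨F, ?_, ?_, hF⟩
  · exact (tendstoUniformlyOn_univ.1 ht).continuous
      (Frequently.of_forall fun n => (contDiff_mollify n hi).continuous)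
  · filter_upwards [ae_tendsto_mollify hi] with y hy
    exact tendsto_nhds_unique (hF y) hy

theorem SmoothPeriodic.eq_of_dirDeriv_eq_zero {f : Plane → ℝ} (hf : SmoothPeriodic f) {w : Plane}
    (h : _root_.dirDeriv w f = 0) (y : Plane) (t : ℝ) : f (y + t • w) = f y := by
  have hd : ∀ s : ℝ, HasDerivAt (fun s : ℝ => f (y + s • w)) 0 s := fun s => by
    have h2 : HasDerivAt (fun s : ℝ => y + s • w) w s := by
      simpa using ((hasDerivAt_id s).smul_const w).const_add y
    have h3 := (hf.differentiableAt (y + s • w)).hasFDerivAt.comp_hasDerivAt s h2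
    have h4 : fderiv ℝ f (y + s • w) w = 0 := congrFun h _
    rwa [h4] at h3
  simpa using is_const_of_deriv_eq_zero (fun s => (hd s).differentiableAt)
    (fun s => (hd s).deriv) t 0

/-- A periodic function of the plane that is constant along the lines orthogonal to the unit
vector `T` is a function of the coordinate along `T`. -/
theorem CellPeriodic.profile {F : Plane → ℝ} (hF : CellPeriodic F) {T : Plane}
    (hT : T 0 ^ 2 + T 1 ^ 2 = 1)
    (hw : ∀ (y : Plane) (t : ℝ), F (y + t • !₂[-T 1, T 0]) = F y) :
    (∀ y : Plane, F y = F ((T 0 * y 0 + T 1 * y 1) • T)) ∧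
      ∀ m n : ℤ, Function.Periodic (fun t : ℝ => F (t • T)) (T 0 * m + T 1 * n) := by
  have h1 : ∀ y : Plane, F y = F ((T 0 * y 0 + T 1 * y 1) • T) := fun y => by
    -- Orthogonal decomposition: `y` is its projection onto `T` plus this multiple of `(-T₂, T₁)`.
    rw [← hw ((T 0 * y 0 + T 1 * y 1) • T) (-T 1 * y 0 + T 0 * y 1)]
    congr 1
    ext i
    fin_cases i
    · simp; linear_combination (-y 0) * hT
    · simp; linear_combination (-y 1) * hT
  refine ⟨h1, fun m n t => ?_⟩
  have h2 := hF.add_lattice (lattice_combination_mem m n) (t • T)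
  rw [h1] at h2
  refine Eq.trans (congrArg (fun r : ℝ => F (r • T)) ?_) h2
  simp
  linear_combination (-t) * hT

theorem periodic_one_of_axis_aligned {f : ℝ → ℝ} {T : Plane} (hT : T 0 ^ 2 + T 1 ^ 2 = 1)
    (hf : ∀ m n : ℤ, Function.Periodic f (T 0 * m + T 1 * n)) (h : T 0 = 0 ∨ T 1 = 0) :
    Function.Periodic f 1 := by
  rcases h with h | h <;> rw [h] at hT
  · have h1 : T 1 = 1 ∨ T 1 = -1 := sq_eq_sq_iff_eq_or_eq_neg.1 (by linarith)
    rcases h1 with h1 | h1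
    · simpa [h, h1] using hf 0 1
    · simpa [h, h1] using hf 0 (-1)
  · have h1 : T 0 = 1 ∨ T 0 = -1 := sq_eq_sq_iff_eq_or_eq_neg.1 (by linarith)
    rcases h1 with h1 | h1
    · simpa [h, h1] using hf 1 0
    · simpa [h, h1] using hf (-1) 0

/-- Here `T = P (p, q)` with `P = T 0 / p`, possibly negative, so Bézout coefficients `u p + v q =
1` exhibit `P` as the period `T 0 * u + T 1 * v`. -/
theorem periodic_of_rational_slope {f : ℝ → ℝ} {T : Plane}
    (hf : ∀ m n : ℤ, Function.Periodic f (T 0 * m + T 1 * n)) {p q : ℤ} (hpq : IsCoprime p q)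
    (hq : q ≠ 0) (h0 : T 0 ≠ 0) (h1 : T 1 ≠ 0) (h : T 0 / T 1 = (p : ℝ) / q) :
    |T 0 / p| = |T 1 / q| ∧ Function.Periodic f |T 0 / p| := by
  have hq' : (q : ℝ) ≠ 0 := Int.cast_ne_zero.2 hq
  have hp' : (p : ℝ) ≠ 0 := by
    intro hp
    rw [hp, zero_div] at h
    exact (div_ne_zero h0 h1) h
  have hcross : T 0 * q = p * T 1 := (div_eq_div_iff h1 hq').1 h
  have he : T 0 / p = T 1 / q := by
    rw [div_eq_div_iff hp' hq']; linarith
  refine ⟨by rw [he], ?_⟩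
  obtain ⟨u, v, huv⟩ := hpq
  have huv' : (u : ℝ) * p + v * q = 1 := by exact_mod_cast huv
  have hper : Function.Periodic f (T 0 / p) := by
    have h2 : T 0 / p = T 0 * u + T 1 * v := by
      rw [div_eq_iff hp']
      linear_combination (-T 0) * huv' + (v : ℝ) * hcross
    rw [h2]; exact hf u v
  rcases abs_choice (T 0 / p) with h2 | h2 <;> rw [h2]
  · exact hper
  · exact hper.neg

/-- The periods contain the subgroup generated by `T 0` and `T 1`, dense when their ratio is
irrational; a continuous function constant on a dense set is constant. -/
theorem constant_of_irrational_slope {f : ℝ → ℝ} (hc : Continuous f) {T : Plane}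
    (hf : ∀ m n : ℤ, Function.Periodic f (T 0 * m + T 1 * n)) (h : Irrational (T 0 / T 1))
    (t : ℝ) : f t = f 0 := by
  have hd := dense_addSubgroupClosure_pair_iff.2 h
  have hp : ∀ x ∈ AddSubgroup.closure {T 0, T 1}, Function.Periodic f x := by
    intro x hx
    induction hx using AddSubgroup.closure_induction with
    | mem x hx =>
      rcases hx with rfl | rfl
      · simpa using hf 1 0
      · simpa using hf 0 1
    | zero => intro y; rw [add_zero]
    | add x y _ _ hx hy => exact hx.add_period hy
    | neg x _ hx => exact hx.neg
  have : f = fun _ => f 0 := hc.ext_on hd continuous_const fun x hx => by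
    simpa using hp x hx 0
  exact congrFun this t

/-! ### Representatives, symmetry of the Hessian, and the conclusion -/

theorem IsWeakDeriv.mixed_ae_eq {v w : Plane} {f a b k l : Plane → ℝ} (pf : CellPeriodic f)
    (da : IsWeakDeriv v f a) (db : IsWeakDeriv w f b) (dk : IsWeakDeriv w a k)
    (dl : IsWeakDeriv v b l) : k =ᵐ[volume] l := by
  filter_upwards [ae_tendsto_mollify dk.2.1, ae_tendsto_mollify dl.2.1] with y h1 h2
  refine tendsto_nhds_unique h1 (h2.congr fun n => ?_)
  rw [← dl.dirDeriv_mollify, ← dk.dirDeriv_mollify, ← da.dirDeriv_mollify,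
    ← db.dirDeriv_mollify, (pf.smoothPeriodic_mollify da.1 n).dirDeriv_comm]

/-- The given Hessian `H` and the square integrable one supplied by `MemH2Per` agree almost
everywhere by uniqueness of weak derivatives. Exact periodicity is what the cell integrals and the
mollifications require. -/
theorem MemH2Per.exists_periodic_representatives {ψ : Plane → ℝ} (hψ : MemH2Per ψ)
    {H : Plane → Matrix (Fin 2) (Fin 2) ℝ} (hH : IsWeakHessian ψ H) :
    ∃ (φ : Plane → ℝ) (g : Fin 2 → Plane → ℝ) (h : Fin 2 → Fin 2 → Plane → ℝ),
      φ =ᵐ[volume] ψ ∧ CellPeriodic φ ∧ MemLp φ 2 cellMeasure ∧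
      (∀ i, IsWeakPartial i φ (g i) ∧ CellPeriodic (g i) ∧ MemLp (g i) 2 cellMeasure) ∧
      ∀ i j, IsWeakPartial j (g i) (h i j) ∧ CellPeriodic (h i j) ∧
        MemLp (h i j) 2 cellMeasure ∧ h i j =ᵐ[volume] fun y => H y i j := by
  obtain ⟨hper, hmem, g, K, hg, hK⟩ := hψ
  obtain ⟨g', hg', hH'⟩ := hH
  have eφ : ψ =ᵐ[volume] periodization ψ := (periodization_ae_eq hper).symm
  have dφ : ∀ i, IsWeakPartial i (periodization ψ) (g i) := fun i =>
    IsWeakDeriv.congr (hg i).1 eφ (by rfl)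
  have eg : ∀ i, g i =ᵐ[volume] periodization (g i) := fun i =>
    (dφ i).ae_eq_periodization (cellPeriodic_periodization ψ)
  have dg : ∀ i j, IsWeakPartial j (periodization (g i)) (fun y => K y i j) := fun i j =>
    IsWeakDeriv.congr (hK i j).1 (eg i) (by rfl)
  have eK : ∀ i j, (fun y => K y i j) =ᵐ[volume] periodization fun y => K y i j := fun i j =>
    (dg i j).ae_eq_periodization (cellPeriodic_periodization (g i))
  refine ⟨periodization ψ, fun i => periodization (g i),
    fun i j => periodization fun y => K y i j, eφ.symm, cellPeriodic_periodization ψ,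
    hmem.ae_eq (ae_restrict_of_ae eφ), fun i => ⟨IsWeakDeriv.congr (dφ i) (by rfl) (eg i),
      cellPeriodic_periodization _, (hg i).2.ae_eq (ae_restrict_of_ae (eg i))⟩,
    fun i j => ⟨IsWeakDeriv.congr (dg i j) (by rfl) (eK i j), cellPeriodic_periodization _,
      (hK i j).2.ae_eq (ae_restrict_of_ae (eK i j)), ?_⟩⟩
  have hgg : g i =ᵐ[volume] g' i := IsWeakDeriv.ae_eq (hg i).1 (hg' i)
  have h1 : IsWeakPartial j (g i) (fun y => H y i j) :=
    IsWeakDeriv.congr (hH' i j) hgg.symm (by rfl)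
  exact (eK i j).symm.trans (IsWeakDeriv.ae_eq (hK i j).1 h1)

theorem CellPeriodic.linear_combination {f g : Plane → ℝ} (hf : CellPeriodic f)
    (hg : CellPeriodic g) (a b : ℝ) : CellPeriodic fun y => a * f y + b * g y :=
  fun i y => by simp only [hf i y, hg i y]

theorem MeasureTheory.MemLp.linear_combination {f g : Plane → ℝ} {p : ℝ≥0∞} {μ : Measure Plane}
    (hf : MemLp f p μ) (hg : MemLp g p μ) (a b : ℝ) : MemLp (fun y => a * f y + b * g y) p μ :=
  (hf.const_mul a).add (hg.const_mul b)

theorem theorem6p1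
    (κ κΓ s : ℝ) (hs : 0 < 1 - s * κΓ)
    (T : Plane) (hT : ‖T‖ = 1)
    (II : Matrix (Fin 2) (Fin 2) ℝ) (hII : II = rankOneForm κ κΓ s T) (hII0 : II ≠ 0)
    (ψ : Plane → ℝ) (hψ : MemH2Per ψ)
    (H : Plane → Matrix (Fin 2) (Fin 2) ℝ) (hH : IsWeakHessian ψ H)
    (hdet : ∀ᵐ y : Plane, (II + H y).det = 0) :
    IsWeakDeriv !₂[-T 1, T 0] ψ (fun _ => 0) ∧
    ∃ ψT : ℝ → ℝ, Continuous ψT ∧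
      (∀ᵐ y : Plane, ψ y = ψT (T 0 * y 0 + T 1 * y 1)) ∧
      ((T 0 = 0 ∨ T 1 = 0) → Function.Periodic ψT 1) ∧
      (∀ p q : ℤ, IsCoprime p q → q ≠ 0 → T 0 ≠ 0 → T 1 ≠ 0 → T 0 / T 1 = (p : ℝ) / q →
        |T 0 / p| = |T 1 / q| ∧ Function.Periodic ψT |T 0 / p|) ∧
      (Irrational (T 0 / T 1) →
        ∃ c : ℝ, (∀ t, ψT t = c) ∧ ∀ᵐ y : Plane, ψ y = c) := by
  have hT2 : T 0 ^ 2 + T 1 ^ 2 = 1 := by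
    have := EuclideanSpace.real_norm_sq_eq T
    rw [hT, Fin.sum_univ_two] at this
    linarith
  set c : ℝ := -(κ / (1 - s * κΓ)) with hc_def
  have hc : c ≠ 0 := by
    intro h
    apply hII0
    rw [hII, rankOneForm, ← hc_def, h, zero_smul]
  obtain ⟨φ, g, h, eφ, pφ, mφ, hg, hh⟩ := hψ.exists_periodic_representatives hH
  set w : Plane := !₂[-T 1, T 0] with hw
  have w0 : w 0 = -T 1 := by simp [hw]
  have w1 : w 1 = T 0 := by simp [hw]
  have hcauchy : ∀ ε > (0 : ℝ), ∃ N, ∀ n ≥ N, ∀ m ≥ N, ∀ y,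
      |mollify n φ y - mollify m φ y| ≤ ε := fun ε hε =>
    mollify_uniformCauchy (hg 0).1 (hg 1).1 (hh 0 1).1 pφ (hg 0).2.1 (hg 1).2.1 (hh 0 1).2.1
      mφ (hg 0).2.2 (hg 1).2.2 (hh 0 1).2.2.1 hε
  -- derivatives in an arbitrary frame
  have dg : ∀ v, IsWeakDeriv v φ fun y => v 0 * g 0 y + v 1 * g 1 y :=
    IsWeakDeriv.of_partials fun i => (hg i).1
  have dh : ∀ v i, IsWeakDeriv v (g i) fun y => v 0 * h i 0 y + v 1 * h i 1 y := fun v i =>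
    IsWeakDeriv.of_partials (fun j => (hh i j).1) v
  have dd : ∀ u v : Plane, IsWeakDeriv u (fun y => v 0 * g 0 y + v 1 * g 1 y) fun y =>
      v 0 * (u 0 * h 0 0 y + u 1 * h 0 1 y) + v 1 * (u 0 * h 1 0 y + u 1 * h 1 1 y) := fun u v =>
    (dh u 0).linear_combination (dh u 1) (v 0) (v 1)
  have pg : ∀ v : Plane, CellPeriodic fun y => v 0 * g 0 y + v 1 * g 1 y := fun v =>
    (hg 0).2.1.linear_combination (hg 1).2.1 _ _
  have mg : ∀ v : Plane, MemLp (fun y => v 0 * g 0 y + v 1 * g 1 y) 2 cellMeasure := fun v =>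
    (hg 0).2.2.linear_combination (hg 1).2.2 _ _
  have pd : ∀ u v : Plane, CellPeriodic fun y =>
      v 0 * (u 0 * h 0 0 y + u 1 * h 0 1 y) + v 1 * (u 0 * h 1 0 y + u 1 * h 1 1 y) := fun u v =>
    ((hh 0 0).2.1.linear_combination (hh 0 1).2.1 _ _).linear_combination
      ((hh 1 0).2.1.linear_combination (hh 1 1).2.1 _ _) _ _
  have md : ∀ u v : Plane, MemLp (fun y =>
      v 0 * (u 0 * h 0 0 y + u 1 * h 0 1 y) + v 1 * (u 0 * h 1 0 y + u 1 * h 1 1 y)) 2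
      cellMeasure := fun u v =>
    ((hh 0 0).2.2.1.linear_combination (hh 0 1).2.2.1 _ _).linear_combination
      ((hh 1 0).2.2.1.linear_combination (hh 1 1).2.2.1 _ _) _ _
  have hsymm : h 0 1 =ᵐ[volume] h 1 0 :=
    IsWeakDeriv.mixed_ae_eq pφ (hg 0).1 (hg 1).1 (hh 0 1).1 (hh 1 0).1
  have hb := weakDeriv_eq_zero_of_det_eq_zero hc (dg T) (dg w) (dd T T) (dd T w) (dd w w) pφ (pg T)
    (pg w) (pd T T) (pd T w) (pd w w) (mg T) (mg w) (md T T) (md T w) (md w w) hcauchy (by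
      filter_upwards [hdet, hsymm, (hh 0 0).2.2.2, (hh 0 1).2.2.2, (hh 1 0).2.2.2,
        (hh 1 1).2.2.2] with y hy e e00 e01 e10 e11
      rw [hII, rankOneForm, ← hc_def, Matrix.det_fin_two] at hy
      simp only [Matrix.add_apply, Matrix.smul_apply, Matrix.of_apply, Matrix.cons_val', Matrix.cons_val_zero,
        Matrix.cons_val_one, Matrix.cons_val_fin_one, smul_eq_mul, ← e00, ← e01, ← e10, ← e11] at hy
      rw [w0, w1, ← e]
      rw [← e] at hy
      -- Passing to the frame `(T, w)` multiplies the Hessian determinant by `|T|⁴`, and `|T|⁴ - 1 =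
      -- (|T|² + 1)(|T|² - 1)`; the terms linear in `c` match exactly.
      linear_combination hy + (h 0 0 y * h 1 1 y - h 0 1 y * h 0 1 y)
        * (T 0 ^ 2 + T 1 ^ 2 + 1) * hT2)
  obtain ⟨F, cF, eF, tF⟩ := exists_continuous_limit_mollify (hg 0).1.1 hcauchy
  have pF : CellPeriodic F := fun i y =>
    tendsto_nhds_unique ((tF _).congr fun n => pφ.mollify n i y) (tF y)
  -- As the weak derivative along `w` vanishes almost everywhere, the derivative of each
  -- mollification along `w` vanishes everywhere; invariance then passes to the pointwise limit `F`.
  have hwF : ∀ (y : Plane) (t : ℝ), F (y + t • w) = F y := fun y t => by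
    refine tendsto_nhds_unique ((tF _).congr fun n => ?_) (tF y)
    refine (pφ.smoothPeriodic_mollify (hg 0).1.1 n).eq_of_dirDeriv_eq_zero ?_ y t
    rw [(dg w).dirDeriv_mollify, mollify_congr n hb]
    ext x
    simp [mollify_apply]
  obtain ⟨hF, hper⟩ := pF.profile hT2 hwF
  have cont : Continuous fun t : ℝ => F (t • T) := cF.comp (by fun_prop)
  have ψF : ∀ᵐ y : Plane, ψ y = F ((T 0 * y 0 + T 1 * y 1) • T) := by
    filter_upwards [eφ, eF] with y h1 h2
    rw [← h1, ← h2]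
    exact hF y
  refine ⟨(dg w).congr eφ hb, fun t => F (t • T), cont, ψF,
    periodic_one_of_axis_aligned hT2 hper,
    fun p q hpq hq h0 h1 hr => periodic_of_rational_slope hper hpq hq h0 h1 hr,
    fun hirr => ⟨_, constant_of_irrational_slope cont hper hirr, ?_⟩⟩
  filter_upwards [ψF] with y hy
  rw [hy]
  exact constant_of_irrational_slope cont hper hirr _
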